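/- For $n\ge 1$ and a real number $c>0$ let $\mathbf F(n,c)$ denote the Fubini--Study space: complex projective space $\mathbb{CP}^n$ with the Kähler metric whose Kähler form is $\sqrt{-1}\,\partial\bar\partial\,\tfrac1c\log(1+|z|^2)$ in every affine chart $z=(\xi_j/\xi_i)_{j\neq i}$ (equivalently, in the rescaled coordinates $Z=z/\sqrt c$, it has the Kähler potential $\tfrac1c\log(1+c|Z|^2)$). Two Kähler manifolds $M,M'$ are called relatives if they share a common Kähler submanifold of positive dimension, that is, if there are a nonempty complex manifold $Z$ with $\dim_{\mathbb C} Z>0$ and holomorphic immersions $f:Z\to M$, $f':Z\to M'$ which induce the same metric on $Z$. Let $a,b$ be natural numbers with $\gcd(a,b)=1$, $1<a<b$ and $a(a+3)<4b+2$. Then $\mathbf F(2,1)$ is a relative neither of $\mathbf F(2,\tfrac ba)$ nor of $\mathbf F(2,\tfrac ab)$. Equivalently, $\mathbf F(2,a)$ and $\mathbf F(2,b)$ are not relatives. (For $a=2$, $b=3$: $\mathbf F(2,1)$ and $\mathbf F(2,\tfrac32)$ are not relatives.) -/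

import Mathlib

open scoped Manifold ContDiff LinearAlgebra.Projectivization

noncomputable section

namespace FubiniStudy

/-- Complex projective space `ℂℙⁿ`, the space of complex lines in `ℂⁿ⁺¹`. -/
abbrev CP (n : ℕ) : Type := ℙ ℂ (EuclideanSpace ℂ (Fin (n + 1)))

/-- `ℂℙⁿ` carries the quotient topology of `ℂⁿ⁺¹ \ {0}`. -/
instance instTopologicalSpaceCP (n : ℕ) : TopologicalSpace (CP n) :=
  inferInstanceAs (TopologicalSpace
    (Quotient (projectivizationSetoid ℂ (EuclideanSpace ℂ (Fin (n + 1))))))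

/-- The inhomogeneous coordinates `(ξ_j / ξ_i)_{j ≠ i}` of a vector `ξ` of `ℂⁿ⁺¹`. -/
def affineCoord {n : ℕ} (i : Fin (n + 1)) (ξ : EuclideanSpace ℂ (Fin (n + 1))) :
    EuclideanSpace ℂ (Fin n) :=
  WithLp.toLp 2 fun j => ξ (i.succAbove j) / ξ i

/-- The vector of `ℂⁿ⁺¹` with `i`-th coordinate `1` and remaining coordinates `z`. -/
def affineLift {n : ℕ} (i : Fin (n + 1)) (z : EuclideanSpace ℂ (Fin n)) :
    EuclideanSpace ℂ (Fin (n + 1)) :=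
  WithLp.toLp 2 (i.insertNth (1 : ℂ) (fun j => z j) : Fin (n + 1) → ℂ)

@[simp]
theorem affineLift_same {n : ℕ} (i : Fin (n + 1)) (z : EuclideanSpace ℂ (Fin n)) :
    affineLift i z i = 1 := by
  simp [affineLift]

@[simp]
theorem affineLift_succAbove {n : ℕ} (i : Fin (n + 1)) (z : EuclideanSpace ℂ (Fin n))
    (j : Fin n) : affineLift i z (i.succAbove j) = z j := by
  simp [affineLift]

theorem affineLift_ne_zero {n : ℕ} (i : Fin (n + 1)) (z : EuclideanSpace ℂ (Fin n)) :
    affineLift i z ≠ 0 := by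
  intro h
  have h1 := affineLift_same i z
  rw [h] at h1
  simp at h1

theorem contDiff_affineLift {n : ℕ} (i : Fin (n + 1)) :
    ContDiff ℂ ω (affineLift (n := n) i) := by
  rw [contDiff_euclidean]
  intro k
  induction k using i.succAboveCases with
  | x => simpa using contDiff_const
  | p j =>
    simp only [affineLift_succAbove]
    fun_prop

theorem contDiffOn_affineCoord {n : ℕ} (i : Fin (n + 1)) :
    ContDiffOn ℂ ω (affineCoord (n := n) i) {ξ | ξ i ≠ 0} := by
  rw [contDiffOn_euclidean]
  intro k
  exact ContDiffOn.div (by fun_prop) (by fun_prop) fun _ h => h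

theorem affineCoord_smul {n : ℕ} (i : Fin (n + 1)) (c : ℂ) (hc : c ≠ 0)
    (ξ : EuclideanSpace ℂ (Fin (n + 1))) : affineCoord i (c • ξ) = affineCoord i ξ := by
  ext j
  simp [affineCoord, mul_div_mul_left _ _ hc]

@[simp]
theorem affineCoord_affineLift {n : ℕ} (i : Fin (n + 1)) (z : EuclideanSpace ℂ (Fin n)) :
    affineCoord i (affineLift i z) = z := by
  ext j
  simp [affineCoord]

theorem affineLift_affineCoord {n : ℕ} (i : Fin (n + 1))
    (ξ : EuclideanSpace ℂ (Fin (n + 1))) (hi : ξ i ≠ 0) :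
    affineLift i (affineCoord i ξ) = (ξ i)⁻¹ • ξ := by
  ext k
  induction k using i.succAboveCases with
  | x => simp [hi]
  | p j => simp [affineCoord, div_eq_inv_mul]

theorem exists_rep_mk {n : ℕ} (ξ : EuclideanSpace ℂ (Fin (n + 1))) (hξ : ξ ≠ 0) :
    ∃ c : ℂ, c ≠ 0 ∧ (Projectivization.mk ℂ ξ hξ : CP n).rep = c • ξ := by
  obtain ⟨c, hc⟩ := Projectivization.exists_smul_eq_mk_rep ℂ ξ hξ
  exact ⟨c, c.ne_zero, hc.symm⟩

theorem rep_mk_apply_ne_zero {n : ℕ} (i : Fin (n + 1)) (ξ : EuclideanSpace ℂ (Fin (n + 1)))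
    (hξ : ξ ≠ 0) : (Projectivization.mk ℂ ξ hξ : CP n).rep i ≠ 0 ↔ ξ i ≠ 0 := by
  obtain ⟨c, hc, h⟩ := exists_rep_mk ξ hξ
  simp [h, hc]

theorem affineCoord_rep_mk {n : ℕ} (i : Fin (n + 1)) (ξ : EuclideanSpace ℂ (Fin (n + 1)))
    (hξ : ξ ≠ 0) :
    affineCoord i (Projectivization.mk ℂ ξ hξ : CP n).rep = affineCoord i ξ := by
  obtain ⟨c, hc, h⟩ := exists_rep_mk ξ hξ
  rw [h, affineCoord_smul i c hc]

theorem isQuotientMap_mk (n : ℕ) : Topology.IsQuotientMap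
    (Projectivization.mk' ℂ : {ξ : EuclideanSpace ℂ (Fin (n + 1)) // ξ ≠ 0} → CP n) :=
  isQuotientMap_quot_mk

theorem isOpen_rep_ne_zero {n : ℕ} (i : Fin (n + 1)) : IsOpen {x : CP n | x.rep i ≠ 0} := by
  rw [← (isQuotientMap_mk n).isOpen_preimage]
  have : (Projectivization.mk' ℂ ⁻¹' {x : CP n | x.rep i ≠ 0}) =
      {ξ : {ξ : EuclideanSpace ℂ (Fin (n + 1)) // ξ ≠ 0} | ξ.1 i ≠ 0} := by
    ext ξ
    exact rep_mk_apply_ne_zero i ξ.1 ξ.2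
  rw [this]
  exact isOpen_ne_fun (by fun_prop) continuous_const

/-- The affine chart `[ξ] ↦ (ξ_j / ξ_i)_{j ≠ i}` on `{ξ_i ≠ 0} ⊆ ℂℙⁿ`. -/
def affineChart {n : ℕ} (i : Fin (n + 1)) :
    OpenPartialHomeomorph (CP n) (EuclideanSpace ℂ (Fin n)) where
  toFun x := affineCoord i x.rep
  invFun z := Projectivization.mk ℂ (affineLift i z) (affineLift_ne_zero i z)
  source := {x | x.rep i ≠ 0}
  target := Set.univ
  map_source' _ _ := Set.mem_univ _
  map_target' z _ := (rep_mk_apply_ne_zero i _ _).2 (by simp)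
  left_inv' x hx := by
    conv_rhs => rw [← x.mk_rep]
    rw [Projectivization.mk_eq_mk_iff']
    exact ⟨(x.rep i)⁻¹, (affineLift_affineCoord i x.rep hx).symm⟩
  right_inv' z _ := by
    rw [affineCoord_rep_mk, affineCoord_affineLift]
  open_source := isOpen_rep_ne_zero i
  open_target := isOpen_univ
  continuousOn_toFun := by
    rw [(isQuotientMap_mk n).continuousOn_isOpen_iff (isOpen_rep_ne_zero i)]
    have h : ContinuousOn (fun ξ : {ξ : EuclideanSpace ℂ (Fin (n + 1)) // ξ ≠ 0} =>
        affineCoord i ξ.1) {ξ | ξ.1 i ≠ 0} :=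
      (contDiffOn_affineCoord i).continuousOn.comp continuous_subtype_val.continuousOn
        fun _ h => h
    refine (h.mono ?_).congr ?_
    · intro ξ hξ
      exact (rep_mk_apply_ne_zero i ξ.1 ξ.2).1 hξ
    · intro ξ _
      exact affineCoord_rep_mk i ξ.1 ξ.2
  continuousOn_invFun := by
    have h : Continuous fun z : EuclideanSpace ℂ (Fin n) =>
        (⟨affineLift i z, affineLift_ne_zero i z⟩ :
          {ξ : EuclideanSpace ℂ (Fin (n + 1)) // ξ ≠ 0}) :=
      (contDiff_affineLift i).continuous.subtype_mk _
    exact ((isQuotientMap_mk n).continuous.comp h).continuousOn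

theorem support_nonempty {n : ℕ} (x : CP n) :
    (Finset.univ.filter fun i => x.rep i ≠ 0).Nonempty := by
  by_contra h
  refine x.rep_nonzero ?_
  ext i
  by_contra hi
  exact h ⟨i, by simpa using hi⟩

/-- The least index of a nonzero homogeneous coordinate. -/
def firstIndex {n : ℕ} (x : CP n) : Fin (n + 1) :=
  (Finset.univ.filter fun i => x.rep i ≠ 0).min' (support_nonempty x)

theorem rep_firstIndex_ne_zero {n : ℕ} (x : CP n) : x.rep (firstIndex x) ≠ 0 := by
  have h := Finset.min'_mem _ (support_nonempty x)
  exact (Finset.mem_filter.1 h).2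

/-- The atlas of the `n + 1` affine charts. -/
instance instChartedSpaceCP (n : ℕ) : ChartedSpace (EuclideanSpace ℂ (Fin n)) (CP n) where
  atlas := Set.range affineChart
  chartAt x := affineChart (firstIndex x)
  mem_chart_source x := rep_firstIndex_ne_zero x
  chart_mem_atlas x := ⟨firstIndex x, rfl⟩

/-- `ℂℙⁿ` is a complex manifold of dimension `n`. -/
instance instIsManifoldCP (n : ℕ) :
    IsManifold 𝓘(ℂ, EuclideanSpace ℂ (Fin n)) ω (CP n) := by
  refine isManifold_of_contDiffOn _ _ _ ?_
  rintro _ _ ⟨i, rfl⟩ ⟨j, rfl⟩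
  have h : ContDiffOn ℂ ω (fun z : EuclideanSpace ℂ (Fin n) => affineCoord j (affineLift i z))
      {z | affineLift i z j ≠ 0} :=
    (contDiffOn_affineCoord j).comp (contDiff_affineLift i).contDiffOn fun _ h => h
  refine (h.mono ?_).congr ?_
  · intro z hz
    have hz' : (Projectivization.mk ℂ (affineLift i z) (affineLift_ne_zero i z) : CP n).rep j
        ≠ 0 := by
      simpa [affineChart] using hz
    exact (rep_mk_apply_ne_zero j _ _).1 hz'
  · intro z _
    exact affineCoord_rep_mk j _ (affineLift_ne_zero i z)

/-- The derivative `∂_v φ = (dφ(v) - i dφ(iv)) / 2` of type `(1,0)`. -/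
def del {E : Type*} [NormedAddCommGroup E] [NormedSpace ℂ E] (φ : E → ℂ) (v : E) (z : E) : ℂ :=
  (fderiv ℝ φ z v - Complex.I * fderiv ℝ φ z (Complex.I • v)) / 2

/-- The derivative `∂̄_w φ = (dφ(w) + i dφ(iw)) / 2` of type `(0,1)`. -/
def delBar {E : Type*} [NormedAddCommGroup E] [NormedSpace ℂ E] (φ : E → ℂ) (w : E) (z : E) :
    ℂ :=
  (fderiv ℝ φ z w + Complex.I * fderiv ℝ φ z (Complex.I • w)) / 2

/-- The Hermitian form `∑ (∂²φ / ∂z_j ∂z̄_k) v_j w̄_k` at `z` attached to the `(1,1)`-form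
`√-1 ∂∂̄φ`, linear in `v` and conjugate linear in `w`. -/
def complexHessian {E : Type*} [NormedAddCommGroup E] [NormedSpace ℂ E] (φ : E → ℝ)
    (z v w : E) : ℂ :=
  del (fun y => delBar (fun x => (φ x : ℂ)) w y) v z

/-- The Kähler potential `(1/b) log (1 + |z|²)` in an affine chart of `ℂℙⁿ`. -/
def potential (n : ℕ) (b : ℝ) (z : EuclideanSpace ℂ (Fin n)) : ℝ :=
  1 / b * Real.log (1 + ‖z‖ ^ 2)

/-- The Kähler metric of the Fubini-Study space `F(n, b)`, for `b > 0`: the Hermitian metric on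
`ℂℙⁿ` whose Kähler form is `√-1 ∂∂̄ ((1/b) log (1 + |z|²))` in every affine chart, that is
`√-1 ∂∂̄ ((1/b) log (1 + b|Z|²))` in the coordinates `Z = z / √b`. A tangent vector at `x` is
given by its coordinates in the chart `chartAt _ x`. The potentials in two affine charts differ by
`(1/b) log |ξ_i / ξ_j|²`, which `∂∂̄` annihilates, so the choice of the chart is immaterial. -/
def metric (n : ℕ) (b : ℝ) (x : CP n)
    (v w : TangentSpace 𝓘(ℂ, EuclideanSpace ℂ (Fin n)) x) : ℂ :=
  complexHessian (potential n b) (chartAt (EuclideanSpace ℂ (Fin n)) x x)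
    (v : EuclideanSpace ℂ (Fin n)) (w : EuclideanSpace ℂ (Fin n))

/-- Two complex manifolds `M` and `M'` with Hermitian metrics `g` and `g'` are relatives if they
share a complex submanifold of positive dimension with its induced metric: there are a nonempty
complex manifold `Z` of dimension `k > 0` and holomorphic immersions `f : Z → M`, `f' : Z → M'`
that induce the same metric on `Z`. -/
def Relatives {E M E' M' : Type*}
    [NormedAddCommGroup E] [NormedSpace ℂ E] [TopologicalSpace M] [ChartedSpace E M]
    [NormedAddCommGroup E'] [NormedSpace ℂ E'] [TopologicalSpace M'] [ChartedSpace E' M']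
    (g : ∀ x : M, TangentSpace 𝓘(ℂ, E) x → TangentSpace 𝓘(ℂ, E) x → ℂ)
    (g' : ∀ x : M', TangentSpace 𝓘(ℂ, E') x → TangentSpace 𝓘(ℂ, E') x → ℂ) : Prop :=
  ∃ (k : ℕ) (Z : Type) (_ : TopologicalSpace Z) (_ : ChartedSpace (EuclideanSpace ℂ (Fin k)) Z),
    0 < k ∧ Nonempty Z ∧ T2Space Z ∧ SecondCountableTopology Z ∧
    IsManifold 𝓘(ℂ, EuclideanSpace ℂ (Fin k)) ω Z ∧
    ∃ (f : Z → M) (f' : Z → M'),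
      MDifferentiable 𝓘(ℂ, EuclideanSpace ℂ (Fin k)) 𝓘(ℂ, E) f ∧
      MDifferentiable 𝓘(ℂ, EuclideanSpace ℂ (Fin k)) 𝓘(ℂ, E') f' ∧
      (∀ z, Function.Injective (mfderiv 𝓘(ℂ, EuclideanSpace ℂ (Fin k)) 𝓘(ℂ, E) f z)) ∧
      (∀ z, Function.Injective (mfderiv 𝓘(ℂ, EuclideanSpace ℂ (Fin k)) 𝓘(ℂ, E') f' z)) ∧
      ∀ (z : Z) (v w : TangentSpace 𝓘(ℂ, EuclideanSpace ℂ (Fin k)) z),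
        g (f z) (mfderiv 𝓘(ℂ, EuclideanSpace ℂ (Fin k)) 𝓘(ℂ, E) f z v)
            (mfderiv 𝓘(ℂ, EuclideanSpace ℂ (Fin k)) 𝓘(ℂ, E) f z w) =
          g' (f' z) (mfderiv 𝓘(ℂ, EuclideanSpace ℂ (Fin k)) 𝓘(ℂ, E') f' z v)
            (mfderiv 𝓘(ℂ, EuclideanSpace ℂ (Fin k)) 𝓘(ℂ, E') f' z w)

end FubiniStudy

end

/-! Restricted to a complex line in a chart of the common submanifold, the two immersions become
holomorphic curves in `ℂℙ²` whose Fubini–Study forms are proportional. After an interchange if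
necessary the ratio `α` is `b / a`, so `α > 1`; it is not `2`, because `b = 2a` with `a > 1`
contradicts coprimality.

Unitary changes of coordinates and a reparametrisation bring the curves to `[1 : z : h(z)]` with `h
= O(z²)`, and `[1 : g₁ : g₂]` with `g₁(0) = g₂(0) = 0` (`exists_normalized_coordinates`,
`false_of_gramForm_eq`). Polarization replaces `conj z` by an independent variable `w`. As both
kernels are `1` on the axes, the `∂∂̄`-equation integrates to `(1 + z w + h(z) h̄(w)) ^ α = 1 +
g₁(z) ḡ₁(w) + g₂(z) ḡ₂(w)`, kept in logarithmic-derivative form (`kernelSnd_mul_kernel_eq`).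

On the right every coefficient of `wⁿ`, `n ≥ 1`, lies in the span of `g₁` and `g₂`. On the left the
coefficients of `w` and `w²` vanish at `z = 0` to order exactly one and two, so they already fill
that span, and those of `w³` and `w⁴`, of order at least two, must be multiples of that of `w²`.
`false_of_coeff_mem_span` shows that this forces `α` to be `0`, `1`, `2`, `1/2` or `1/3`. The value
`2` is a true exception: `(1 + zw)² = 1 + 2zw + z²w²` is a line against a conic. -/

namespace FubiniStudy

/-! ### Formal power series: the coefficients of `A ^ α` and the rank-two obstruction -/

open PowerSeries ComplexConjugate

/-- The coefficients up to order four of a power series `B = A ^ α`, where the relation is given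
in the form `α A' B = A B'`. -/
theorem coeff_of_logDeriv_eq {K : Type*} [Field K] [CharZero K] (α : K) (A B : K⟦X⟧)
    (hA : coeff 0 A = 1) (hB : coeff 0 B = 1)
    (h : C α * (derivative K A * B) = A * derivative K B) :
    coeff 1 B = α * coeff 1 A ∧
    coeff 2 B = α * coeff 2 A + α * (α - 1) / 2 * coeff 1 A ^ 2 ∧
    coeff 3 B = α * coeff 3 A + α * (α - 1) * (coeff 1 A * coeff 2 A) +
      α * (α - 1) * (α - 2) / 6 * coeff 1 A ^ 3 ∧
    coeff 4 B = α * coeff 4 A +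
      α * (α - 1) / 2 * (2 * (coeff 1 A * coeff 3 A) + coeff 2 A ^ 2) +
      α * (α - 1) * (α - 2) / 2 * (coeff 1 A ^ 2 * coeff 2 A) +
      α * (α - 1) * (α - 2) * (α - 3) / 24 * coeff 1 A ^ 4 := by
  -- The derivative shifts degrees by one: degrees `0` to `3` of the relation determine the
  -- coefficients `1` to `4` of `B` recursively.
  have h0 := congrArg (coeff 0) h
  have h1 := congrArg (coeff 1) h
  have h2 := congrArg (coeff 2) h
  have h3 := congrArg (coeff 3) h
  rw [coeff_C_mul] at h0 h1 h2 h3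
  simp only [coeff_mul, Finset.Nat.antidiagonal_succ, Finset.Nat.antidiagonal_zero,
    Finset.sum_cons, Finset.map_cons, Finset.map_singleton, Finset.sum_singleton,
    Function.Embedding.prodMap, Function.Embedding.coeFn_mk, Prod.map, coeff_derivative,
    Function.Embedding.refl_apply, Nat.succ_eq_add_one, hA, hB] at h0 h1 h2 h3
  norm_num [hA, hB] at h0 h1 h2 h3
  have e1 : coeff 1 B = α * coeff 1 A := h0.symm
  rw [e1] at h1 h2 h3
  have e2 : coeff 2 B = α * coeff 2 A + α * (α - 1) / 2 * coeff 1 A ^ 2 := by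
    linear_combination -h1 / 2
  rw [e2] at h2 h3
  have e3 : coeff 3 B = α * coeff 3 A + α * (α - 1) * (coeff 1 A * coeff 2 A) +
      α * (α - 1) * (α - 2) / 6 * coeff 1 A ^ 3 := by
    linear_combination -h2 / 3
  rw [e3] at h3
  refine ⟨e1, e2, e3, ?_⟩
  linear_combination -h3 / 4

/-- If `A = 1 + X w + H H₂ w² + …` then the coefficients of `w, …, w⁴` in `A ^ α` do not lie in a
space of power series of dimension two. -/
theorem false_of_coeff_mem_span (α : ℝ) (hα : 1 < α) (hα2 : α ≠ 2) (H G₁ G₂ : ℂ⟦X⟧)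
    (H0 : coeff 0 H = 0) (H1 : coeff 1 H = 0) (u v : ℕ → ℂ)
    (h1 : C (u 1) * G₁ + C (v 1) * G₂ = C (α : ℂ) * X)
    (h2 : C (u 2) * G₁ + C (v 2) * G₂ =
      C (α * conj (coeff 2 H)) * H + C (α * (α - 1) / 2 : ℂ) * X ^ 2)
    (h3 : C (u 3) * G₁ + C (v 3) * G₂ =
      C (α * conj (coeff 3 H)) * H + C (α * (α - 1) * conj (coeff 2 H)) * (X * H) +
        C (α * (α - 1) * (α - 2) / 6 : ℂ) * X ^ 3)
    (h4 : C (u 4) * G₁ + C (v 4) * G₂ =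
      C (α * conj (coeff 4 H)) * H + C (α * (α - 1) * conj (coeff 3 H)) * (X * H) +
        C (α * (α - 1) / 2 * conj (coeff 2 H) ^ 2) * H ^ 2 +
        C (α * (α - 1) * (α - 2) / 2 * conj (coeff 2 H)) * (X ^ 2 * H) +
        C (α * (α - 1) * (α - 2) * (α - 3) / 24 : ℂ) * X ^ 4) : False := by
  have hα0 : (α : ℂ) ≠ 0 := by exact_mod_cast (by linarith : α ≠ 0)
  have hα1 : (α : ℂ) - 1 ≠ 0 := by exact_mod_cast (by linarith : α - 1 ≠ 0)
  have hα2' : (α : ℂ) - 2 ≠ 0 := by exact_mod_cast sub_ne_zero.2 hα2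
  set s := (α : ℂ) with hs
  set c := conj (coeff 2 H) with hc
  set d := conj (coeff 3 H) with hd
  set e := conj (coeff 4 H) with he
  -- From here on the coefficients of `w²`, `w³`, `w⁴` are divided by `X ^ 2`; `N` is the quotient
  -- for `w²`.
  obtain ⟨U, rfl⟩ : ∃ U : ℂ⟦X⟧, H = X ^ 2 * U := by
    rw [← dvd_def, X_pow_dvd_iff]
    intro m hm
    interval_cases m <;> assumption
  have k1 : ∀ W : ℂ⟦X⟧, coeff 1 (X ^ 2 * W) = 0 := fun W => by simp [coeff_X_pow_mul']
  have k2 : ∀ W : ℂ⟦X⟧, coeff 2 (X ^ 2 * W) = coeff 0 W := fun W => by simp [coeff_X_pow_mul']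
  set N := C (s * c) * U + C (s * (s - 1) / 2) with hN
  have h2' : C (u 2) * G₁ + C (v 2) * G₂ = X ^ 2 * N := by
    rw [h2, hN]; ring
  -- The constant term is `α |U(0)|² + α (α - 1) / 2`, positive because `α > 1`.
  have hN0 : coeff 0 N ≠ 0 := by
    have : coeff 0 N = ((α * Complex.normSq (coeff 0 U) + α * (α - 1) / 2 : ℝ) : ℂ) := by
      rw [hN, hc, k2, map_add, coeff_C_mul]
      push_cast
      rw [← Complex.mul_conj]
      simp
      ring
    rw [this]
    have h5 : 0 ≤ α * Complex.normSq (coeff 0 U) :=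
      mul_nonneg (by linarith) (Complex.normSq_nonneg _)
    have h6 : 0 < α * (α - 1) / 2 := by
      have : 0 < α * (α - 1) := mul_pos (by linarith) (by linarith)
      linarith
    exact_mod_cast (by linarith : α * Complex.normSq (coeff 0 U) + α * (α - 1) / 2 ≠ 0)
  -- Otherwise `s X` and `X ^ 2 N` satisfy two linear relations; since `N(0) ≠ 0`, degree two gives
  -- `u 1 = v 1 = 0`, against `h1`.
  have hD : u 1 * v 2 - u 2 * v 1 ≠ 0 := by
    intro hD
    have r1 : C (u 2) * (C s * X) - C (u 1) * (X ^ 2 * N) = 0 := by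
      rw [← h1, ← h2']
      have := congrArg (C (R := ℂ)) hD
      simp only [map_sub, map_mul, map_zero] at this
      linear_combination -G₂ * this
    have r2 : C (v 2) * (C s * X) - C (v 1) * (X ^ 2 * N) = 0 := by
      rw [← h1, ← h2']
      have := congrArg (C (R := ℂ)) hD
      simp only [map_sub, map_mul, map_zero] at this
      linear_combination G₁ * this
    have r1' := congrArg (coeff 2) r1
    have r2' := congrArg (coeff 2) r2
    simp only [map_sub, coeff_C_mul, k2, map_zero, coeff_X] at r1' r2'
    have hu : u 1 = 0 := by
      have : u 1 * coeff 0 N = 0 := by simpa using r1'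
      exact (mul_eq_zero.1 this).resolve_right hN0
    have hv : v 1 = 0 := by
      have : v 1 * coeff 0 N = 0 := by simpa using r2'
      exact (mul_eq_zero.1 this).resolve_right hN0
    rw [hu, hv] at h1
    have := congrArg (coeff 1) h1
    simp only [coeff_C_mul, coeff_one_X] at this
    simp at this
    exact hα0 this.symm
  -- Cramer's rule writes `X ^ 2 W` through `s X` and `X ^ 2 N`; the term in `X` drops out by
  -- comparing degree one.
  have cramer : ∀ (k : ℕ) (W : ℂ⟦X⟧), C (u k) * G₁ + C (v k) * G₂ = X ^ 2 * W →
      ∃ l : ℂ, W = C l * N := by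
    intro k W hW
    have r : C (u 1 * v 2 - u 2 * v 1) * (X ^ 2 * W) =
        C (u k * v 2 - u 2 * v k) * (C s * X) + C (u 1 * v k - u k * v 1) * (X ^ 2 * N) := by
      rw [← h1, ← h2', ← hW]
      simp only [map_sub, map_mul]
      ring
    have r1 := congrArg (coeff 1) r
    simp only [map_add, coeff_C_mul, k1, coeff_one_X] at r1
    have r2 : u k * v 2 - u 2 * v k = 0 := by simpa [hα0] using r1.symm
    rw [r2] at r
    refine ⟨(u 1 * v k - u k * v 1) / (u 1 * v 2 - u 2 * v 1), ?_⟩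
    have hX : (X ^ 2 : ℂ⟦X⟧) ≠ 0 := pow_ne_zero _ X_ne_zero
    apply mul_left_cancel₀ hX
    have r3 := congrArg (fun f => C (u 1 * v 2 - u 2 * v 1)⁻¹ * f) r
    simp only [← mul_assoc, ← map_mul, inv_mul_cancel₀ hD] at r3
    rw [div_eq_inv_mul]
    simp only [map_mul, map_zero, map_one] at r3 ⊢
    linear_combination r3
  obtain ⟨l, hl⟩ := cramer 3 (C (s * d) * U + C (s * (s - 1) * c) * (X * U) +
    C (s * (s - 1) * (s - 2) / 6) * X) (by rw [h3]; ring)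
  obtain ⟨m, hm⟩ := cramer 4 (C (s * e) * U + C (s * (s - 1) * d) * (X * U) +
    C (s * (s - 1) / 2 * c ^ 2) * (X ^ 2 * U ^ 2) +
    C (s * (s - 1) * (s - 2) / 2 * c) * (X ^ 2 * U) +
    C (s * (s - 1) * (s - 2) * (s - 3) / 24) * X ^ 2) (by rw [h4]; ring)
  have hUd : coeff 1 U = conj d := by rw [hd]; simp [coeff_X_pow_mul']
  have hUe : coeff 2 U = conj e := by rw [he]; simp [coeff_X_pow_mul']
  -- If `c = 0` then `N` is constant. The `w³` relation gives `|d|² = -(α - 1)(α - 2) / 6` in degree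
  -- one and `e = 0` in degree two; degree two of the `w⁴` relation then contradicts this value of
  -- `|d|²`.
  by_cases hc0 : c = 0
  · have hN' : N = C (s * (s - 1) / 2) := by rw [hN, hc0]; simp
    rw [hN', hc0] at hl hm
    simp only [mul_zero, map_zero, zero_mul, add_zero, ne_eq, OfNat.ofNat_ne_zero,
      not_false_eq_true, zero_pow, ← map_mul] at hl hm
    have q1 := congrArg (coeff 1) hl
    have q2 := congrArg (coeff 2) hl
    have q3 := congrArg (coeff 2) hm
    simp only [map_add, coeff_C_mul, coeff_X, coeff_C, hUd, hUe] at q1 q2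
    have cX : coeff 2 (X * U) = coeff 1 U := coeff_succ_X_mul 1 U
    simp only [map_add, coeff_C_mul, coeff_X_pow, coeff_C, hUe, cX, hUd] at q3
    norm_num at q1 q2 q3
    have hd0 : d ≠ 0 := by
      intro h
      simp [h, hα0, hα1, hα2'] at q1
    have he0 : e = 0 := by
      simpa [hα0, hd0] using q2
    rw [he0] at q3
    have hdd : d * conj d = -((s - 1) * (s - 2) / 6) := by
      apply mul_left_cancel₀ hα0
      linear_combination q1
    have q4 : s * (s - 1) * (s - 2) * (3 * s - 1) = 0 := by
      linear_combination 24 * s * (s - 1) * hdd - 24 * q3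
    have : 3 * s - 1 ≠ 0 := by
      rw [hs]; exact_mod_cast (by linarith : 3 * α - 1 ≠ 0)
    simp [hα0, hα1, hα2', this] at q4
  -- If `c ≠ 0`, the `w³` relation makes `U` a quotient of two polynomials of degree at most one in
  -- `X`.
  · have hU : (C (s * d - l * s * c) + C (s * (s - 1) * c) * X) * U =
        C (l * s * (s - 1) / 2) - C (s * (s - 1) * (s - 2) / 6) * X := by
      have : C (l * s * (s - 1) / 2) = C l * C (s * (s - 1) / 2) := by rw [← map_mul]; ring_nf
      rw [hN] at hl
      rw [this]
      simp only [map_sub, map_mul] at hl ⊢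
      linear_combination hl
    have hm' : C (s * e - m * (s * c)) * U + C (s * (s - 1) * d) * (X * U) +
        C (s * (s - 1) / 2 * c ^ 2) * (X ^ 2 * U ^ 2) +
        C (s * (s - 1) * (s - 2) / 2 * c) * (X ^ 2 * U) +
        C (s * (s - 1) * (s - 2) * (s - 3) / 24) * X ^ 2 - C (m * (s * (s - 1) / 2)) = 0 := by
      rw [hN] at hm
      simp only [map_sub, map_mul (C (R := ℂ)) m] at hm ⊢
      linear_combination hm
    -- Substituting `U` in the `w⁴` relation and clearing the squared denominator leaves a
    -- polynomial of degree at most four that is zero. Its leading coefficient, the behaviour as `X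
    -- → ∞` with `U → -N₁ / D₁`, no longer involves the unknowns `l`, `m`, `d`, `e`.
    have quartic : ∀ p q r₂ r₁ r₀ f D₀ D₁ N₀ N₁ : ℂ,
        (C D₀ + C D₁ * X) * U = C N₀ - C N₁ * X →
        C p * U + C q * (X * U) + C r₂ * (X ^ 2 * U ^ 2) + C r₁ * (X ^ 2 * U) + C r₀ * X ^ 2 -
          C f = 0 →
        r₂ * N₁ ^ 2 - r₁ * N₁ * D₁ + r₀ * D₁ ^ 2 = 0 := by
      intro p q r₂ r₁ r₀ f D₀ D₁ N₀ N₁ hD hP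
      have h : C (r₂ * N₁ ^ 2 - r₁ * N₁ * D₁ + r₀ * D₁ ^ 2) * X ^ 4 +
          C (-q * N₁ * D₁ - 2 * r₂ * N₀ * N₁ + r₁ * (N₀ * D₁ - N₁ * D₀) + 2 * r₀ * D₀ * D₁) *
            X ^ 3 +
          C (-p * N₁ * D₁ + q * (N₀ * D₁ - N₁ * D₀) + r₂ * N₀ ^ 2 + r₁ * N₀ * D₀ + r₀ * D₀ ^ 2 -
            f * D₁ ^ 2) * X ^ 2 +
          C (p * (N₀ * D₁ - N₁ * D₀) + q * N₀ * D₀ - 2 * f * D₀ * D₁) * X +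
          C (p * N₀ * D₀ - f * D₀ ^ 2) = 0 := by
        simp only [map_add, map_sub, map_mul, map_neg, map_pow, map_ofNat]
        set D := C D₀ + C D₁ * X with hDd
        linear_combination D ^ 2 * hP - (C p * D + C q * X * D + C r₁ * X ^ 2 * D +
          C r₂ * X ^ 2 * (D * U + C N₀ - C N₁ * X)) * hD
      have lead : ∀ k₄ k₃ k₂ k₁ k₀ : ℂ, C k₄ * X ^ 4 + C k₃ * X ^ 3 + C k₂ * X ^ 2 + C k₁ * X +
          C k₀ = 0 → k₄ = 0 := by
        intro k₄ k₃ k₂ k₁ k₀ hk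
        simpa [coeff_X_pow, coeff_X, coeff_C] using congrArg (coeff 4) hk
      exact lead _ _ _ _ _ h
    have h5 := quartic _ _ _ _ _ _ _ _ _ _ hU hm'
    have h6 : (s * (s - 1)) ^ 3 * c ^ 2 * (s - 2) * (2 * s - 1) = 0 := by
      linear_combination (-72) * h5
    have : 2 * s - 1 ≠ 0 := by
      rw [hs]; exact_mod_cast (by linarith : 2 * α - 1 ≠ 0)
    simp [hα0, hα1, hα2', this, hc0] at h6

end FubiniStudy

/-! ### Taylor series, conjugation and polarization -/

namespace FubiniStudy

open PowerSeries ComplexConjugate Filter Topology Metric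

/-- The Taylor series at the origin. -/
noncomputable def taylorSeries (f : ℂ → ℂ) : ℂ⟦X⟧ :=
  PowerSeries.mk fun n => iteratedDeriv n f 0 / n.factorial

theorem coeff_taylorSeries (f : ℂ → ℂ) (n : ℕ) :
    coeff n (taylorSeries f) = iteratedDeriv n f 0 / n.factorial := by
  simp [taylorSeries]

theorem taylorSeries_congr {f g : ℂ → ℂ} (h : f =ᶠ[𝓝 0] g) : taylorSeries f = taylorSeries g := by
  ext n
  rw [coeff_taylorSeries, coeff_taylorSeries, h.iteratedDeriv_eq]

theorem taylorSeries_const (c : ℂ) : taylorSeries (fun _ => c) = C c := by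
  ext n
  rw [coeff_taylorSeries, coeff_C, iteratedDeriv_const]
  split_ifs with h <;> simp [h]

theorem taylorSeries_id : taylorSeries (fun z => z) = X := by
  ext n
  rw [coeff_taylorSeries, coeff_X, iteratedDeriv_fun_id_zero]
  split_ifs with h <;> simp [h]

theorem taylorSeries_add {f g : ℂ → ℂ} (hf : AnalyticAt ℂ f 0) (hg : AnalyticAt ℂ g 0) :
    taylorSeries (fun z => f z + g z) = taylorSeries f + taylorSeries g := by
  ext n
  rw [map_add, coeff_taylorSeries, coeff_taylorSeries, coeff_taylorSeries,
    iteratedDeriv_fun_add hf.contDiffAt hg.contDiffAt, add_div]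

theorem taylorSeries_mul {f g : ℂ → ℂ} (hf : AnalyticAt ℂ f 0) (hg : AnalyticAt ℂ g 0) :
    taylorSeries (fun z => f z * g z) = taylorSeries f * taylorSeries g := by
  ext n
  rw [coeff_mul, coeff_taylorSeries, iteratedDeriv_fun_mul hf.contDiffAt hg.contDiffAt,
    Finset.Nat.sum_antidiagonal_eq_sum_range_succ
      (fun i j => coeff i (taylorSeries f) * coeff j (taylorSeries g)), Finset.sum_div]
  refine Finset.sum_congr rfl fun i hi => ?_
  have hi' : i ≤ n := Nat.lt_succ_iff.1 (Finset.mem_range.1 hi)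
  rw [coeff_taylorSeries, coeff_taylorSeries, Nat.cast_choose ℂ hi']
  have h1 : (n.factorial : ℂ) ≠ 0 := by exact_mod_cast n.factorial_ne_zero
  field_simp

theorem taylorSeries_pow_two {f : ℂ → ℂ} (hf : AnalyticAt ℂ f 0) :
    taylorSeries (fun z => f z ^ 2) = taylorSeries f ^ 2 := by
  simp only [pow_two, taylorSeries_mul hf hf]

theorem taylorSeries_const_mul (c : ℂ) {f : ℂ → ℂ} (hf : AnalyticAt ℂ f 0) :
    taylorSeries (fun z => c * f z) = C c * taylorSeries f := by
  rw [taylorSeries_mul analyticAt_const hf, taylorSeries_const]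

theorem taylorSeries_pow_id (n : ℕ) : taylorSeries (fun z => z ^ n) = X ^ n := by
  induction n with
  | zero => simpa using taylorSeries_const 1
  | succ n ih =>
    simp only [pow_succ]
    rw [taylorSeries_mul (f := fun z => z ^ n) (g := fun z => z) (by fun_prop) (by fun_prop), ih,
      taylorSeries_id]

theorem taylorSeries_deriv (f : ℂ → ℂ) :
    taylorSeries (deriv f) = derivative ℂ (taylorSeries f) := by
  ext n
  rw [coeff_derivative, coeff_taylorSeries, coeff_taylorSeries, ← iteratedDeriv_succ',
    Nat.factorial_succ]
  have h1 : (n.factorial : ℂ) ≠ 0 := by exact_mod_cast n.factorial_ne_zero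
  have h2 : (n : ℂ) + 1 ≠ 0 := by exact_mod_cast n.succ_ne_zero
  push_cast
  field_simp

/-- The holomorphic function `z ↦ conj (f (conj z))`. -/
def conjConj (f : ℂ → ℂ) : ℂ → ℂ := conj ∘ f ∘ conj

theorem conjConj_conj (f : ℂ → ℂ) (z : ℂ) : conjConj f (conj z) = conj (f z) := by
  simp [conjConj]

theorem deriv_conjConj (f : ℂ → ℂ) : deriv (conjConj f) = conjConj (deriv f) :=
  deriv_conj_conj

theorem iteratedDeriv_conjConj (f : ℂ → ℂ) (n : ℕ) :
    iteratedDeriv n (conjConj f) = conjConj (iteratedDeriv n f) := by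
  induction n with
  | zero => simp
  | succ n ih => rw [iteratedDeriv_succ, iteratedDeriv_succ, ih, deriv_conjConj]

theorem coeff_taylorSeries_conjConj (f : ℂ → ℂ) (n : ℕ) :
    coeff n (taylorSeries (conjConj f)) = conj (coeff n (taylorSeries f)) := by
  rw [coeff_taylorSeries, coeff_taylorSeries, iteratedDeriv_conjConj]
  simp [conjConj]

theorem differentiableOn_conjConj {f : ℂ → ℂ} {r : ℝ} (hf : DifferentiableOn ℂ f (ball 0 r)) :
    DifferentiableOn ℂ (conjConj f) (ball 0 r) := by
  intro z hz
  have hz' : conj z ∈ ball (0 : ℂ) r := by simpa using hz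
  have := (hf.differentiableAt (isOpen_ball.mem_nhds hz')).conj_conj
  rw [Complex.conj_conj] at this
  exact this.differentiableWithinAt

theorem analyticAt_of_differentiableOn_ball {f : ℂ → ℂ} {r : ℝ} (hr : 0 < r)
    (hf : DifferentiableOn ℂ f (ball 0 r)) : AnalyticAt ℂ f 0 :=
  hf.analyticAt (ball_mem_nhds 0 hr)

/-- Identity theorem: the real points accumulate at `0` inside a connected ball. -/
theorem eqOn_zero_of_eq_zero_on_real {f : ℂ → ℂ} {r : ℝ} (hr : 0 < r)
    (hf : DifferentiableOn ℂ f (ball 0 r)) (h : ∀ x : ℝ, |x| < r → f x = 0) :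
    ∀ z ∈ ball (0 : ℂ) r, f z = 0 := by
  refine (hf.analyticOnNhd isOpen_ball).eqOn_zero_of_preconnected_of_frequently_eq_zero
    (convex_ball 0 r).isPreconnected (mem_ball_self hr) ?_
  have ht : Tendsto (fun x : ℝ => (x : ℂ)) (𝓝[≠] 0) (𝓝[≠] 0) := by
    refine tendsto_nhdsWithin_iff.2 ⟨?_, ?_⟩
    · have := Complex.continuous_ofReal.tendsto 0
      simp only [Complex.ofReal_zero] at this
      exact this.mono_left nhdsWithin_le_nhds
    · filter_upwards [self_mem_nhdsWithin] with x hx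
      simpa using hx
  refine ht.frequently (Eventually.frequently ?_)
  have : ∀ᶠ x : ℝ in 𝓝 0, |x| < r := by
    have := ball_mem_nhds (0 : ℝ) hr
    filter_upwards [this] with x hx
    simpa using hx
  exact (this.filter_mono nhdsWithin_le_nhds).mono h

/-- Polarization: a holomorphic function of two variables that vanishes on `w = conj z` is zero. -/
theorem eq_zero_of_eq_zero_on_conj {Φ : ℂ × ℂ → ℂ} {r : ℝ} (hr : 0 < r)
    (hΦ : DifferentiableOn ℂ Φ (ball 0 r ×ˢ ball 0 r))
    (h : ∀ z ∈ ball (0 : ℂ) r, Φ (z, conj z) = 0) :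
    ∀ z ∈ ball (0 : ℂ) (r / 2), ∀ w ∈ ball (0 : ℂ) (r / 2), Φ (z, w) = 0 := by
  have hr2 : 0 < r / 2 := by linarith
  have mem : ∀ x y : ℂ, ‖x‖ < r / 2 → ‖y‖ < r / 2 →
      (x + Complex.I * y, x - Complex.I * y) ∈ ball (0 : ℂ) r ×ˢ ball (0 : ℂ) r := by
    intro x y hx hy
    have hI : ‖Complex.I * y‖ = ‖y‖ := by simp
    simp only [Set.mem_prod, mem_ball_zero_iff]
    exact ⟨by linarith [norm_add_le x (Complex.I * y)], by linarith [norm_sub_le x (Complex.I * y)]⟩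
  -- In the coordinates `z = x + i y`, `w = x - i y` the set `w = conj z` is that of real `x` and
  -- `y`. First `y` is freed, then `x`; the halved radius keeps both points in the original ball.
  have step : ∀ x : ℝ, |x| < r / 2 → ∀ y ∈ ball (0 : ℂ) (r / 2),
      Φ ((x : ℂ) + Complex.I * y, (x : ℂ) - Complex.I * y) = 0 := by
    intro x hx
    have hx' : ‖(x : ℂ)‖ < r / 2 := by simpa using hx
    refine eqOn_zero_of_eq_zero_on_real hr2
      (f := fun y : ℂ => Φ ((x : ℂ) + Complex.I * y, (x : ℂ) - Complex.I * y)) ?_ ?_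
    · refine hΦ.comp (by fun_prop) fun y hy => mem x y hx' (by simpa using hy)
    · intro y hy
      have hy' : ‖(y : ℂ)‖ < r / 2 := by simpa using hy
      have := h _ (mem x y hx' hy').1
      simpa [sub_eq_add_neg] using this
  have step2 : ∀ y ∈ ball (0 : ℂ) (r / 2), ∀ x ∈ ball (0 : ℂ) (r / 2),
      Φ (x + Complex.I * y, x - Complex.I * y) = 0 := by
    intro y hy
    refine eqOn_zero_of_eq_zero_on_real hr2
      (f := fun x : ℂ => Φ (x + Complex.I * y, x - Complex.I * y)) ?_
      (fun x hx => step x hx y hy)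
    exact hΦ.comp (by fun_prop) fun x hx => mem x y (by simpa using hx) (by simpa using hy)
  intro z hz w hw
  rw [mem_ball_zero_iff] at hz hw
  have hx : ‖(z + w) / 2‖ < r / 2 := by
    rw [norm_div, Complex.norm_two]
    linarith [norm_add_le z w]
  have hy : ‖-Complex.I * ((z - w) / 2)‖ < r / 2 := by
    rw [norm_mul, norm_neg, Complex.norm_I, one_mul, norm_div, Complex.norm_two]
    linarith [norm_sub_le z w]
  have := step2 _ (mem_ball_zero_iff.2 hy) _ (mem_ball_zero_iff.2 hx)
  have e : Complex.I * (-Complex.I * ((z - w) / 2)) = (z - w) / 2 := by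
    linear_combination -((z - w) / 2) * Complex.I_mul_I
  rw [e] at this
  convert this using 2
  ring_nf

end FubiniStudy

/-! ### Polarized kernels and the integrated metric equation -/

namespace FubiniStudy

open PowerSeries ComplexConjugate Filter Topology Metric

/-- The polarization in `(z, w)` of `1 + |p|² + |q|²`. -/
def kernel (p q : ℂ → ℂ) (z w : ℂ) : ℂ := 1 + p z * conjConj p w + q z * conjConj q w

/-- The derivative of the kernel in the first variable. -/
noncomputable def kernelFst (p q : ℂ → ℂ) (z w : ℂ) : ℂ :=
  deriv p z * conjConj p w + deriv q z * conjConj q w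

/-- The derivative of the kernel in the second variable. -/
noncomputable def kernelSnd (p q : ℂ → ℂ) (z w : ℂ) : ℂ :=
  p z * conjConj (deriv p) w + q z * conjConj (deriv q) w

/-- The mixed second derivative of the kernel. -/
noncomputable def kernelMixed (p q : ℂ → ℂ) (z w : ℂ) : ℂ :=
  deriv p z * conjConj (deriv p) w + deriv q z * conjConj (deriv q) w

/-- The numerator `K K_zw - K_z K_w` of the mixed second derivative of `log K`. -/
noncomputable def kernelLevi (p q : ℂ → ℂ) (z w : ℂ) : ℂ :=
  kernel p q z w * kernelMixed p q z w - kernelFst p q z w * kernelSnd p q z w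

theorem differentiableOn_mul_prod {f g : ℂ → ℂ} {r : ℝ}
    (hf : DifferentiableOn ℂ f (ball 0 r))
    (hg : DifferentiableOn ℂ g (ball 0 r)) :
    DifferentiableOn ℂ (fun x : ℂ × ℂ => f x.1 * g x.2) (ball 0 r ×ˢ ball 0 r) :=
  (hf.comp differentiableOn_fst fun _ h => h.1).mul
    (hg.comp differentiableOn_snd fun _ h => h.2)

theorem differentiableOn_kernel {p q : ℂ → ℂ} {r : ℝ} (hp : DifferentiableOn ℂ p (ball 0 r))
    (hq : DifferentiableOn ℂ q (ball 0 r)) :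
    DifferentiableOn ℂ (fun x : ℂ × ℂ => kernel p q x.1 x.2) (ball 0 r ×ˢ ball 0 r) :=
  ((differentiableOn_const _).add
    (differentiableOn_mul_prod hp (differentiableOn_conjConj hp))).add
    (differentiableOn_mul_prod hq (differentiableOn_conjConj hq))

theorem differentiableOn_kernelLevi {p q : ℂ → ℂ} {r : ℝ} (hp : DifferentiableOn ℂ p (ball 0 r))
    (hq : DifferentiableOn ℂ q (ball 0 r)) :
    DifferentiableOn ℂ (fun x : ℂ × ℂ => kernelLevi p q x.1 x.2) (ball 0 r ×ˢ ball 0 r) := by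
  have hp' := hp.deriv isOpen_ball
  have hq' := hq.deriv isOpen_ball
  have sp := differentiableOn_conjConj hp
  have sq := differentiableOn_conjConj hq
  have sp' := differentiableOn_conjConj hp'
  have sq' := differentiableOn_conjConj hq'
  exact ((differentiableOn_kernel hp hq).mul
    ((differentiableOn_mul_prod hp' sp').add (differentiableOn_mul_prod hq' sq'))).sub
    (((differentiableOn_mul_prod hp' sp).add (differentiableOn_mul_prod hq' sq)).mul
    ((differentiableOn_mul_prod hp sp').add (differentiableOn_mul_prod hq sq')))

theorem hasDerivAt_kernel {p q : ℂ → ℂ} {z : ℂ} (hp : DifferentiableAt ℂ p z)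
    (hq : DifferentiableAt ℂ q z) (w : ℂ) :
    HasDerivAt (fun z => kernel p q z w) (kernelFst p q z w) z :=
  ((hp.hasDerivAt.mul_const _).const_add 1).add (hq.hasDerivAt.mul_const _)

theorem hasDerivAt_kernelSnd {p q : ℂ → ℂ} {z : ℂ} (hp : DifferentiableAt ℂ p z)
    (hq : DifferentiableAt ℂ q z) (w : ℂ) :
    HasDerivAt (fun z => kernelSnd p q z w) (kernelMixed p q z w) z :=
  (hp.hasDerivAt.mul_const _).add (hq.hasDerivAt.mul_const _)

theorem exists_kernel_ne_zero {p q : ℂ → ℂ} {r : ℝ} (hr : 0 < r)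
    (hp : DifferentiableOn ℂ p (ball 0 r)) (hq : DifferentiableOn ℂ q (ball 0 r))
    (hp0 : p 0 = 0) (hq0 : q 0 = 0) :
    ∃ ρ > 0, ∀ z ∈ ball (0 : ℂ) ρ, ∀ w ∈ ball (0 : ℂ) ρ, kernel p q z w ≠ 0 := by
  have h0 : kernel p q 0 0 ≠ 0 := by simp [kernel, hp0, hq0]
  have hc : ContinuousAt (fun x : ℂ × ℂ => kernel p q x.1 x.2) (0, 0) :=
    (differentiableOn_kernel hp hq).continuousOn.continuousAt
      (prod_mem_nhds (ball_mem_nhds 0 hr) (ball_mem_nhds 0 hr))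
  obtain ⟨ρ, hρ, h⟩ := Metric.mem_nhds_iff.1 (hc.eventually_ne h0)
  refine ⟨ρ, hρ, fun z hz w hw => ?_⟩
  rw [← ball_prod_same] at h
  exact h (Set.mk_mem_prod hz hw)

/-- If `α ∂∂̄ log (1 + |p|² + |q|²) = ∂∂̄ log (1 + |g₁|² + |g₂|²)` and all functions vanish at the
origin, then `A ^ α = B` for the polarized kernels; the conclusion is the logarithmic derivative in
the second variable of this equation. -/
theorem kernelSnd_mul_kernel_eq {α : ℂ} {p q g₁ g₂ : ℂ → ℂ} {r : ℝ} (hr : 0 < r)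
    (hp : DifferentiableOn ℂ p (ball 0 r)) (hq : DifferentiableOn ℂ q (ball 0 r))
    (hg₁ : DifferentiableOn ℂ g₁ (ball 0 r)) (hg₂ : DifferentiableOn ℂ g₂ (ball 0 r))
    (hp0 : p 0 = 0) (hq0 : q 0 = 0) (hg₁0 : g₁ 0 = 0) (hg₂0 : g₂ 0 = 0)
    (h : ∀ z ∈ ball (0 : ℂ) r, α * kernelLevi p q z (conj z) * kernel g₁ g₂ z (conj z) ^ 2 =
      kernelLevi g₁ g₂ z (conj z) * kernel p q z (conj z) ^ 2) :
    ∃ ρ > 0, ρ ≤ r ∧ ∀ z ∈ ball (0 : ℂ) ρ, ∀ w ∈ ball (0 : ℂ) ρ,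
      α * (kernelSnd p q z w * kernel g₁ g₂ z w) = kernel p q z w * kernelSnd g₁ g₂ z w := by
  have pol := eq_zero_of_eq_zero_on_conj hr
    (Φ := fun x => α * kernelLevi p q x.1 x.2 * kernel g₁ g₂ x.1 x.2 ^ 2 -
      kernelLevi g₁ g₂ x.1 x.2 * kernel p q x.1 x.2 ^ 2)
    ((((differentiableOn_const α).mul (differentiableOn_kernelLevi hp hq)).mul
      ((differentiableOn_kernel hg₁ hg₂).pow 2)).sub
      ((differentiableOn_kernelLevi hg₁ hg₂).mul ((differentiableOn_kernel hp hq).pow 2)))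
    (fun z hz => sub_eq_zero.2 (h z hz))
  obtain ⟨ρ₁, hρ₁, hA⟩ := exists_kernel_ne_zero hr hp hq hp0 hq0
  obtain ⟨ρ₂, hρ₂, hB⟩ := exists_kernel_ne_zero hr hg₁ hg₂ hg₁0 hg₂0
  set ρ := min (r / 2) (min ρ₁ ρ₂) with hρdef
  have hρ : 0 < ρ := by positivity
  have le0 : ρ ≤ r / 2 := min_le_left _ _
  have le1 : ρ ≤ ρ₁ := (min_le_right _ _).trans (min_le_left _ _)
  have le2 : ρ ≤ ρ₂ := (min_le_right _ _).trans (min_le_right _ _)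
  refine ⟨ρ, hρ, by linarith, fun z hz w hw => ?_⟩
  have hAne : ∀ z ∈ ball (0 : ℂ) ρ, kernel p q z w ≠ 0 := fun z hz =>
    hA z (ball_subset_ball le1 hz) w (ball_subset_ball le1 hw)
  have hBne : ∀ z ∈ ball (0 : ℂ) ρ, kernel g₁ g₂ z w ≠ 0 := fun z hz =>
    hB z (ball_subset_ball le2 hz) w (ball_subset_ball le2 hw)
  -- The `z`-derivative of `K_w / K` is `kernelLevi / K²`, so the polarized hypothesis says that
  -- this difference does not depend on `z`; its value at `z = 0` is zero.
  have hder : ∀ z ∈ ball (0 : ℂ) ρ, HasDerivAt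
      (fun z => α * (kernelSnd p q z w / kernel p q z w) - kernelSnd g₁ g₂ z w / kernel g₁ g₂ z w)
      0 z := by
    intro z hz
    have hz' : ball (0 : ℂ) r ∈ 𝓝 z :=
      isOpen_ball.mem_nhds (ball_subset_ball (by linarith) hz)
    have dp := hp.differentiableAt hz'
    have dq := hq.differentiableAt hz'
    have d1 := hg₁.differentiableAt hz'
    have d2 := hg₂.differentiableAt hz'
    have key := pol z (ball_subset_ball le0 hz) w (ball_subset_ball le0 hw)
    have := (((hasDerivAt_kernelSnd dp dq w).div (hasDerivAt_kernel dp dq w)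
      (hAne z hz)).const_mul α).sub
      ((hasDerivAt_kernelSnd d1 d2 w).div (hasDerivAt_kernel d1 d2 w) (hBne z hz))
    refine this.congr_deriv ?_
    have := hAne z hz
    have := hBne z hz
    field_simp
    simp only [kernelLevi] at key
    linear_combination key
  have hconst := isOpen_ball.is_const_of_deriv_eq_zero (convex_ball (0 : ℂ) ρ).isPreconnected
    (fun z hz => (hder z hz).differentiableAt.differentiableWithinAt)
    (fun z hz => (hder z hz).deriv) hz (mem_ball_self hρ)
  have hA0 : kernelSnd p q 0 w = 0 := by simp [kernelSnd, hp0, hq0]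
  have hB0 : kernelSnd g₁ g₂ 0 w = 0 := by simp [kernelSnd, hg₁0, hg₂0]
  rw [hA0, hB0] at hconst
  have := hAne z hz
  have := hBne z hz
  field_simp at hconst
  simp only [mul_zero] at hconst
  linear_combination hconst

theorem taylorSeries_kernel {p q : ℂ → ℂ} (hp : AnalyticAt ℂ (conjConj p) 0)
    (hq : AnalyticAt ℂ (conjConj q) 0) (z : ℂ) :
    taylorSeries (kernel p q z) =
      1 + C (p z) * taylorSeries (conjConj p) + C (q z) * taylorSeries (conjConj q) := by
  unfold kernel
  rw [taylorSeries_add (f := fun w => 1 + p z * conjConj p w) (by fun_prop) (by fun_prop),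
    taylorSeries_add (f := fun w => 1) (by fun_prop) (by fun_prop), taylorSeries_const,
    taylorSeries_const_mul _ hp, taylorSeries_const_mul _ hq, map_one]

theorem taylorSeries_kernelSnd {p q : ℂ → ℂ} (hp : AnalyticAt ℂ (conjConj p) 0)
    (hq : AnalyticAt ℂ (conjConj q) 0) (z : ℂ) :
    taylorSeries (kernelSnd p q z) = derivative ℂ (taylorSeries (kernel p q z)) := by
  rw [← taylorSeries_deriv]
  refine taylorSeries_congr ?_
  filter_upwards [hp.eventually_analyticAt, hq.eventually_analyticAt] with w hpw hqw
  have := ((hpw.differentiableAt.hasDerivAt.const_mul (p z)).const_add 1).add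
    (hqw.differentiableAt.hasDerivAt.const_mul (q z))
  rw [deriv_conjConj, deriv_conjConj] at this
  exact this.deriv.symm

/-- A holomorphic curve `(z, h)` in an affine chart of `ℂℙ²`, with `h` vanishing to second order,
and a holomorphic curve `(g₁, g₂)` through the origin do not induce proportional metrics with a
factor `α > 1` other than `2`. -/
theorem false_of_normalized_curves {α : ℝ} (hα : 1 < α) (hα2 : α ≠ 2) {h g₁ g₂ : ℂ → ℂ} {r : ℝ}
    (hr : 0 < r) (hh : DifferentiableOn ℂ h (ball 0 r))
    (hg₁ : DifferentiableOn ℂ g₁ (ball 0 r)) (hg₂ : DifferentiableOn ℂ g₂ (ball 0 r))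
    (hh0 : h 0 = 0) (hh1 : deriv h 0 = 0) (hg₁0 : g₁ 0 = 0) (hg₂0 : g₂ 0 = 0)
    (heq : ∀ z ∈ ball (0 : ℂ) r,
      α * kernelLevi (fun t => t) h z (conj z) * kernel g₁ g₂ z (conj z) ^ 2 =
      kernelLevi g₁ g₂ z (conj z) * kernel (fun t => t) h z (conj z) ^ 2) : False := by
  obtain ⟨ρ, hρ, hρr, key⟩ := kernelSnd_mul_kernel_eq hr differentiableOn_id hh hg₁ hg₂ rfl hh0
    hg₁0 hg₂0 heq
  have an := fun {f : ℂ → ℂ} (hf : DifferentiableOn ℂ f (ball 0 r)) =>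
    analyticAt_of_differentiableOn_ball hr (differentiableOn_conjConj hf)
  have aid := an (f := fun t => t) differentiableOn_id
  have ah := an hh
  have a1 := an hg₁
  have a2 := an hg₂
  have bh := analyticAt_of_differentiableOn_ball hr hh
  have b1 := analyticAt_of_differentiableOn_ball hr hg₁
  have b2 := analyticAt_of_differentiableOn_ball hr hg₂
  set H := taylorSeries h with hH
  have H0 : coeff 0 H = 0 := by rw [hH, coeff_taylorSeries]; simp [hh0]
  have H1 : coeff 1 H = 0 := by rw [hH, coeff_taylorSeries]; simp [hh1]
  have G₁0 : coeff 0 (taylorSeries g₁) = 0 := by rw [coeff_taylorSeries]; simp [hg₁0]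
  have G₂0 : coeff 0 (taylorSeries g₂) = 0 := by rw [coeff_taylorSeries]; simp [hg₂0]
  have cid : conjConj (fun t => t) = fun t => t := by ext t; simp [conjConj]
  have cA : ∀ (z : ℂ) (n : ℕ), coeff n (taylorSeries (kernel (fun t => t) h z)) =
      (if n = 0 then 1 else 0) + z * (if n = 1 then 1 else 0) + h z * conj (coeff n H) := by
    intro z n
    rw [taylorSeries_kernel aid ah, cid, taylorSeries_id, map_add, map_add, coeff_C_mul,
      coeff_C_mul, coeff_X, coeff_one, coeff_taylorSeries_conjConj]
  have cB : ∀ (z : ℂ) (n : ℕ), coeff n (taylorSeries (kernel g₁ g₂ z)) =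
      (if n = 0 then 1 else 0) + g₁ z * conj (coeff n (taylorSeries g₁)) +
        g₂ z * conj (coeff n (taylorSeries g₂)) := by
    intro z n
    rw [taylorSeries_kernel a1 a2, map_add, map_add, coeff_C_mul, coeff_C_mul, coeff_one,
      coeff_taylorSeries_conjConj, coeff_taylorSeries_conjConj]
  -- For fixed `z` both kernels are expanded in `w`; the resulting coefficient identities are then
  -- read as identities between functions of `z`.
  have coeffs := fun z (hz : z ∈ ball (0 : ℂ) ρ) =>
    coeff_of_logDeriv_eq (α : ℂ) (taylorSeries (kernel (fun t => t) h z))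
      (taylorSeries (kernel g₁ g₂ z)) (by rw [cA]; simp [H0]) (by rw [cB]; simp [G₁0, G₂0]) (by
        rw [← taylorSeries_kernelSnd aid ah, ← taylorSeries_kernelSnd a1 a2]
        have akA : AnalyticAt ℂ (kernel (fun t => t) h z) 0 := by unfold kernel; fun_prop
        have akB : AnalyticAt ℂ (kernel g₁ g₂ z) 0 := by unfold kernel; fun_prop
        have ak : ∀ {p q : ℂ → ℂ}, DifferentiableOn ℂ p (ball 0 r) →
            DifferentiableOn ℂ q (ball 0 r) → AnalyticAt ℂ (kernelSnd p q z) 0 := by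
          intro p q hp hq
          have h1 := an (hp.deriv isOpen_ball)
          have h2 := an (hq.deriv isOpen_ball)
          unfold kernelSnd
          fun_prop
        have asA := ak (p := fun t => t) differentiableOn_id hh
        have asB := ak hg₁ hg₂
        rw [← taylorSeries_mul asA akB, ← taylorSeries_mul akA asB,
          ← taylorSeries_const_mul _ (asA.fun_mul akB)]
        refine taylorSeries_congr ?_
        filter_upwards [ball_mem_nhds (0 : ℂ) hρ] with w hw
        exact key z hz w hw)
  simp only [cA, cB, H1, OfNat.ofNat_ne_zero, OfNat.ofNat_ne_one, one_ne_zero, if_true, if_false,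
    map_zero, mul_zero, mul_one, zero_add, add_zero] at coeffs
  have ev := ball_mem_nhds (0 : ℂ) hρ
  have aid' : AnalyticAt ℂ (fun z : ℂ => z) 0 := analyticAt_id
  have lhs : ∀ n, taylorSeries (fun z => conj (coeff n (taylorSeries g₁)) * g₁ z +
      conj (coeff n (taylorSeries g₂)) * g₂ z) =
      C (conj (coeff n (taylorSeries g₁))) * taylorSeries g₁ +
      C (conj (coeff n (taylorSeries g₂))) * taylorSeries g₂ := by
    intro n
    rw [taylorSeries_add (by fun_prop) (by fun_prop), taylorSeries_const_mul _ b1,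
      taylorSeries_const_mul _ b2]
  -- The multipliers are the conjugated Taylor coefficients: the coefficient of `wⁿ` in `g₁(z)
  -- ḡ₁(w)` is `g₁(z)` times the conjugate of the `n`-th coefficient of `g₁`.
  refine false_of_coeff_mem_span α hα hα2 H (taylorSeries g₁) (taylorSeries g₂) H0 H1
    (fun n => conj (coeff n (taylorSeries g₁))) (fun n => conj (coeff n (taylorSeries g₂)))
    ?_ ?_ ?_ ?_
  all_goals
    simp only [← lhs, hH]
  · rw [← taylorSeries_id, ← taylorSeries_const_mul _ aid']
    refine taylorSeries_congr ?_
    filter_upwards [ev] with z hz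
    linear_combination (coeffs z hz).1
  · rw [← taylorSeries_pow_id, ← taylorSeries_const_mul _ bh,
      ← taylorSeries_const_mul _ (by fun_prop), ← taylorSeries_add (by fun_prop) (by fun_prop)]
    refine taylorSeries_congr ?_
    filter_upwards [ev] with z hz
    linear_combination (coeffs z hz).2.1
  · rw [← taylorSeries_pow_id, ← taylorSeries_id, ← taylorSeries_const_mul _ bh,
      ← taylorSeries_mul aid' bh, ← taylorSeries_const_mul _ (by fun_prop),
      ← taylorSeries_const_mul _ (by fun_prop), ← taylorSeries_add (by fun_prop) (by fun_prop),
      ← taylorSeries_add (by fun_prop) (by fun_prop)]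
    refine taylorSeries_congr ?_
    filter_upwards [ev] with z hz
    linear_combination (coeffs z hz).2.2.1
  · rw [← taylorSeries_pow_id, ← taylorSeries_pow_id, ← taylorSeries_id,
      ← taylorSeries_const_mul _ bh, ← taylorSeries_pow_two bh,
      ← taylorSeries_mul aid' bh, ← taylorSeries_mul (by fun_prop) bh,
      ← taylorSeries_const_mul _ (by fun_prop), ← taylorSeries_const_mul _ (by fun_prop),
      ← taylorSeries_const_mul _ (by fun_prop), ← taylorSeries_const_mul _ (by fun_prop),
      ← taylorSeries_add (by fun_prop) (by fun_prop),
      ← taylorSeries_add (by fun_prop) (by fun_prop),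
      ← taylorSeries_add (by fun_prop) (by fun_prop),
      ← taylorSeries_add (by fun_prop) (by fun_prop)]
    refine taylorSeries_congr ?_
    filter_upwards [ev] with z hz
    linear_combination (coeffs z hz).2.2.2

end FubiniStudy

/-! ### Unitary normalization and reparametrization of curves in `ℂℙ²` -/

namespace FubiniStudy

open ComplexConjugate Filter Topology Metric InnerProductSpace

theorem kernel_conj (p q : ℂ → ℂ) (z : ℂ) :
    kernel p q z (conj z) = 1 + p z * conj (p z) + q z * conj (q z) := by
  simp [kernel, conjConj_conj]

theorem kernelLevi_conj (p q : ℂ → ℂ) (z : ℂ) :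
    kernelLevi p q z (conj z) = (1 + p z * conj (p z) + q z * conj (q z)) *
      (deriv p z * conj (deriv p z) + deriv q z * conj (deriv q z)) -
      (deriv p z * conj (p z) + deriv q z * conj (q z)) *
      (p z * conj (deriv p z) + q z * conj (deriv q z)) := by
  simp [kernelLevi, kernelMixed, kernelFst, kernelSnd, kernel, conjConj_conj]

theorem kernel_conj_ne_zero (p q : ℂ → ℂ) (z : ℂ) : kernel p q z (conj z) ≠ 0 := by
  rw [kernel_conj, Complex.mul_conj, Complex.mul_conj]
  have h1 := Complex.normSq_nonneg (p z)
  have h2 := Complex.normSq_nonneg (q z)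
  exact_mod_cast (by positivity : 1 + Complex.normSq (p z) + Complex.normSq (q z) ≠ 0)

/-- The value on `v` of the Fubini-Study form at the line through `x`, for a vector `v`
representing a tangent vector at that line. -/
noncomputable def gramForm {E : Type*} [NormedAddCommGroup E] [InnerProductSpace ℂ E] (x v : E) :
    ℂ :=
  (inner ℂ x x * inner ℂ v v - inner ℂ v x * inner ℂ x v) / inner ℂ x x ^ 2

theorem gramForm_map {E E' : Type*} [NormedAddCommGroup E] [InnerProductSpace ℂ E]
    [NormedAddCommGroup E'] [InnerProductSpace ℂ E'] (L : E ≃ₗᵢ[ℂ] E') (x v : E) :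
    gramForm (L x) (L v) = gramForm x v := by
  simp [gramForm]

/-- In suitable unitary coordinates a holomorphic curve in `ℂℙ²` is `z ↦ [1 : p : q]` with
`p(0) = q(0) = q'(0) = 0`. -/
theorem exists_normalized_coordinates {X : ℂ → EuclideanSpace ℂ (Fin 3)} {r : ℝ} (hr : 0 < r)
    (hX : DifferentiableOn ℂ X (ball 0 r)) (hX0 : X 0 ≠ 0) :
    ∃ ρ > 0, ρ ≤ r ∧ ∃ p q : ℂ → ℂ, DifferentiableOn ℂ p (ball 0 ρ) ∧
      DifferentiableOn ℂ q (ball 0 ρ) ∧ p 0 = 0 ∧ q 0 = 0 ∧ deriv q 0 = 0 ∧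
      (deriv p 0 = 0 → ∃ c : ℂ, deriv X 0 = c • X 0) ∧
      ∀ z ∈ ball (0 : ℂ) ρ, gramForm (X z) (deriv X z) =
        kernelLevi p q z (conj z) / kernel p q z (conj z) ^ 2 := by
  have hcard : Module.finrank ℂ (EuclideanSpace ℂ (Fin 3)) = Fintype.card (Fin 3) := by simp
  -- Gram–Schmidt on the point and the velocity, padded by `0`: triangularity kills coordinates `1`,
  -- `2` of `X 0` and coordinate `2` of `deriv X 0`.
  set b := gramSchmidtOrthonormalBasis hcard ![X 0, deriv X 0, 0] with hb
  have o1 : b.repr (X 0) 1 = 0 :=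
    gramSchmidtOrthonormalBasis_inv_triangular' hcard ![X 0, deriv X 0, 0]
      (i := 0) (j := 1) (by decide)
  have o2 : b.repr (X 0) 2 = 0 :=
    gramSchmidtOrthonormalBasis_inv_triangular' hcard ![X 0, deriv X 0, 0]
      (i := 0) (j := 2) (by decide)
  have o3 : b.repr (deriv X 0) 2 = 0 :=
    gramSchmidtOrthonormalBasis_inv_triangular' hcard ![X 0, deriv X 0, 0]
      (i := 1) (j := 2) (by decide)
  have o0 : b.repr (X 0) 0 ≠ 0 := by
    intro h
    apply hX0
    apply b.repr.injective
    ext j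
    fin_cases j <;> simp [h, o1, o2]
  have hder : ∀ z ∈ ball (0 : ℂ) r, ∀ j, HasDerivAt (fun z => b.repr (X z) j)
      (b.repr (deriv X z) j) z := by
    intro z hz j
    have h1 := (hX.differentiableAt (isOpen_ball.mem_nhds hz)).hasDerivAt
    exact ((EuclideanSpace.proj j).comp
      (b.repr.toContinuousLinearEquiv : _ →L[ℂ] EuclideanSpace ℂ (Fin 3))).hasFDerivAt.comp_hasDerivAt
      z h1
  have hne : ∀ᶠ z in 𝓝 (0 : ℂ), b.repr (X z) 0 ≠ 0 :=
    (hder 0 (mem_ball_self hr) 0).continuousAt.eventually_ne o0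
  obtain ⟨ρ', hρ', hball⟩ := Metric.eventually_nhds_iff_ball.1 hne
  set ρ := min ρ' r
  have hρ : 0 < ρ := by positivity
  have hρr : ball (0 : ℂ) ρ ⊆ ball 0 r := ball_subset_ball (min_le_right _ _)
  have hne' : ∀ z ∈ ball (0 : ℂ) ρ, b.repr (X z) 0 ≠ 0 := fun z hz =>
    hball z (ball_subset_ball (min_le_left _ _) hz)
  have hquot : ∀ j, ∀ z ∈ ball (0 : ℂ) ρ,
      HasDerivAt (fun z => b.repr (X z) j / b.repr (X z) 0)
      ((b.repr (deriv X z) j * b.repr (X z) 0 - b.repr (X z) j * b.repr (deriv X z) 0) /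
        b.repr (X z) 0 ^ 2) z := fun j z hz =>
    (hder z (hρr hz) j).div (hder z (hρr hz) 0) (hne' z hz)
  have h0 := mem_ball_self (x := (0 : ℂ)) hρ
  refine ⟨ρ, hρ, min_le_right _ _, fun z => b.repr (X z) 1 / b.repr (X z) 0,
    fun z => b.repr (X z) 2 / b.repr (X z) 0,
    fun z hz => (hquot 1 z hz).differentiableAt.differentiableWithinAt,
    fun z hz => (hquot 2 z hz).differentiableAt.differentiableWithinAt,
    by simp [o1], by simp [o2], ?_, ?_, ?_⟩
  · rw [(hquot 2 0 h0).deriv, o2, o3]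
    simp
  · intro h
    rw [(hquot 1 0 h0).deriv, o1] at h
    have h1 : b.repr (deriv X 0) 1 = 0 := by simpa [o0] using h
    refine ⟨b.repr (deriv X 0) 0 / b.repr (X 0) 0, ?_⟩
    apply b.repr.injective
    ext j
    fin_cases j <;> simp [h1, o1, o2, o3, o0]
  · intro z hz
    rw [← gramForm_map b.repr]
    have hK := kernel_conj_ne_zero (fun z => b.repr (X z) 1 / b.repr (X z) 0)
      (fun z => b.repr (X z) 2 / b.repr (X z) 0) z
    rw [kernel_conj] at hK ⊢
    rw [kernelLevi_conj, (hquot 1 z hz).deriv, (hquot 2 z hz).deriv]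
    have hne := hne' z hz
    generalize b.repr (X z) = x at *
    generalize b.repr (deriv X z) = v
    have hc : conj (x 0) ≠ 0 := by simpa using hne
    simp only [gramForm, PiLp.inner_apply, Fin.sum_univ_three, RCLike.inner_apply, map_div₀,
      map_sub, map_mul, map_pow] at hK ⊢
    have e : 1 + x 1 / x 0 * (conj (x 1) / conj (x 0)) + x 2 / x 0 * (conj (x 2) / conj (x 0)) =
        (x 0 * conj (x 0) + x 1 * conj (x 1) + x 2 * conj (x 2)) / (x 0 * conj (x 0)) := by
      field_simp
    rw [e] at hK ⊢
    have hS : x 0 * conj (x 0) + x 1 * conj (x 1) + x 2 * conj (x 2) ≠ 0 := by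
      intro h
      simp [h] at hK
    field_simp
    ring

/-- Inverse function theorem; it supplies the parameter in which the first affine coordinate of the
curve is `t` itself. -/
theorem exists_holomorphic_inverse {p : ℂ → ℂ} {r : ℝ} (hr : 0 < r)
    (hp : DifferentiableOn ℂ p (ball 0 r)) (hp0 : p 0 = 0) (hp1 : deriv p 0 ≠ 0) :
    ∃ ρ > 0, ∃ ψ : ℂ → ℂ, DifferentiableOn ℂ ψ (ball 0 ρ) ∧ ψ 0 = 0 ∧
      ∀ t ∈ ball (0 : ℂ) ρ, ψ t ∈ ball (0 : ℂ) r ∧ p (ψ t) = t := by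
  have han := analyticAt_of_differentiableOn_ball hr hp
  have hcd : ContDiffAt ℂ 1 p 0 := han.contDiffAt
  set e := ContinuousLinearEquiv.unitsEquivAut ℂ (Units.mk0 (deriv p 0) hp1)
  have hd : HasFDerivAt p (e : ℂ →L[ℂ] ℂ) 0 :=
    han.differentiableAt.hasDerivAt.hasFDerivAt_equiv hp1
  set ψ := hcd.localInverse hd one_ne_zero with hψ
  have hψ0 : ψ 0 = 0 := by
    have := hcd.localInverse_apply_image hd one_ne_zero
    rwa [hp0] at this
  have hψcd : ContDiffAt ℂ 1 ψ 0 := by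
    have := hcd.to_localInverse hd one_ne_zero
    rwa [hp0] at this
  have e1 : ∀ᶠ t in 𝓝 (0 : ℂ), DifferentiableAt ℂ ψ t :=
    (hψcd.eventually (by simp)).mono fun t ht => ht.differentiableAt one_ne_zero
  have e2 : ∀ᶠ t in 𝓝 (0 : ℂ), p (ψ t) = t := by
    have := (hcd.hasStrictFDerivAt' hd one_ne_zero).eventually_right_inverse
    rwa [hp0] at this
  have e3 : ∀ᶠ t in 𝓝 (0 : ℂ), ψ t ∈ ball (0 : ℂ) r := by
    have := hψcd.continuousAt
    refine this.eventually_mem ?_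
    rw [hψ0]
    exact ball_mem_nhds 0 hr
  obtain ⟨ρ, hρ, h⟩ := Metric.eventually_nhds_iff_ball.1 (e1.and (e2.and e3))
  exact ⟨ρ, hρ, ψ, fun t ht => (h t ht).1.differentiableWithinAt, hψ0,
    fun t ht => ⟨(h t ht).2.2, (h t ht).2.1⟩⟩

/-- Two holomorphic curves in `ℂℙ²` do not induce proportional metrics with a factor `α > 1` other
than `2`, if the first one is immersed. -/
theorem false_of_gramForm_eq {α : ℝ} (hα : 1 < α) (hα2 : α ≠ 2)
    {X Y : ℂ → EuclideanSpace ℂ (Fin 3)} {r : ℝ} (hr : 0 < r)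
    (hX : DifferentiableOn ℂ X (ball 0 r)) (hY : DifferentiableOn ℂ Y (ball 0 r))
    (hX0 : X 0 ≠ 0) (hY0 : Y 0 ≠ 0) (himm : ∀ c : ℂ, deriv X 0 ≠ c • X 0)
    (heq : ∀ z ∈ ball (0 : ℂ) r,
      α * gramForm (X z) (deriv X z) = gramForm (Y z) (deriv Y z)) : False := by
  obtain ⟨ρ₁, hρ₁, hρ₁r, p, q, hp, hq, hp0, hq0, hq1, hp1, hpq⟩ :=
    exists_normalized_coordinates hr hX hX0
  obtain ⟨ρ₂, hρ₂, -, g₁, g₂, hg₁, hg₂, hg₁0, hg₂0, -, -, hg⟩ :=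
    exists_normalized_coordinates hr hY hY0
  have hp1' : deriv p 0 ≠ 0 := fun h => by
    obtain ⟨c, hc⟩ := hp1 h
    exact himm c hc
  have s1 : ball (0 : ℂ) (min ρ₁ ρ₂) ⊆ ball 0 ρ₁ := ball_subset_ball (min_le_left _ _)
  have s2 : ball (0 : ℂ) (min ρ₁ ρ₂) ⊆ ball 0 ρ₂ := ball_subset_ball (min_le_right _ _)
  obtain ⟨ρ, hρ, ψ, hψ, hψ0, hψp⟩ :=
    exists_holomorphic_inverse (lt_min hρ₁ hρ₂) (hp.mono s1) hp0 hp1'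
  have m1 : Set.MapsTo ψ (ball 0 ρ) (ball 0 ρ₁) := fun t ht => s1 (hψp t ht).1
  have m2 : Set.MapsTo ψ (ball 0 ρ) (ball 0 ρ₂) := fun t ht => s2 (hψp t ht).1
  have chain : ∀ {f : ℂ → ℂ} {ρ' : ℝ}, DifferentiableOn ℂ f (ball 0 ρ') →
      Set.MapsTo ψ (ball 0 ρ) (ball 0 ρ') → ∀ t ∈ ball (0 : ℂ) ρ,
      deriv (f ∘ ψ) t = deriv f (ψ t) * deriv ψ t := fun hf hm t ht =>
    deriv_comp t (hf.differentiableAt (isOpen_ball.mem_nhds (hm ht)))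
      (hψ.differentiableAt (isOpen_ball.mem_nhds ht))
  refine false_of_normalized_curves hα hα2 hρ (hq.comp hψ m1) (hg₁.comp hψ m2) (hg₂.comp hψ m2)
    (by simp [hψ0, hq0]) ?_ (by simp [hψ0, hg₁0]) (by simp [hψ0, hg₂0]) ?_
  · rw [chain hq m1 0 (mem_ball_self hρ), hψ0, hq1, zero_mul]
  · intro t ht
    have h1 := hpq _ (m1 ht)
    have h2 := hg _ (m2 ht)
    have h3 := heq _ (ball_subset_ball hρ₁r (m1 ht))
    have hpψ : p (ψ t) = t := (hψp t ht).2
    have hone : deriv p (ψ t) * deriv ψ t = 1 := by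
      rw [← chain hp m1 t ht]
      have : p ∘ ψ =ᶠ[𝓝 t] fun t => t := by
        filter_upwards [isOpen_ball.mem_nhds ht] with s hs
        exact (hψp s hs).2
      rw [this.deriv_eq]
      simp
    have hone' := congrArg conj hone
    rw [map_mul, map_one] at hone'
    rw [h1, h2] at h3
    have n1 := kernel_conj_ne_zero p q (ψ t)
    have n2 := kernel_conj_ne_zero g₁ g₂ (ψ t)
    rw [mul_div_assoc', div_eq_div_iff (pow_ne_zero 2 n1) (pow_ne_zero 2 n2)] at h3
    rw [kernelLevi_conj, kernel_conj, kernelLevi_conj, kernel_conj, hpψ] at h3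
    rw [kernelLevi_conj, kernel_conj, kernelLevi_conj, kernel_conj, chain hq m1 t ht,
      chain hg₁ m2 t ht, chain hg₂ m2 t ht]
    -- Writing the derivative `1` as `p' ψ'` makes `|ψ'|²` a common factor of both Levi forms.
    have hid : deriv (fun t : ℂ => t) t = deriv p (ψ t) * deriv ψ t := by rw [hone]; simp
    rw [hid]
    simp only [Function.comp_apply, map_mul]
    linear_combination (deriv ψ t * conj (deriv ψ t)) * h3

end FubiniStudy

/-! ### The complex Hessian of the Fubini–Study potential -/

namespace FubiniStudy

open ComplexConjugate Filter Topology Metric InnerProductSpace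

section Hessian

variable {n : ℕ}

theorem hasFDerivAt_one_add_norm_sq (y : EuclideanSpace ℂ (Fin n)) :
    HasFDerivAt (fun x : EuclideanSpace ℂ (Fin n) => 1 + ‖x‖ ^ 2) (2 • innerSL ℝ y) y :=
  (hasStrictFDerivAt_norm_sq y).hasFDerivAt.const_add 1

theorem one_add_norm_sq_ne_zero (y : EuclideanSpace ℂ (Fin n)) : 1 + ‖y‖ ^ 2 ≠ 0 := by
  positivity

theorem innerSL_real_apply (y w : EuclideanSpace ℂ (Fin n)) :
    innerSL ℝ y w = (inner ℂ y w).re := by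
  simp [PiLp.inner_apply, Complex.inner, mul_comm]

theorem re_sub_I_mul_re (s : ℂ) : (s.re : ℂ) - Complex.I * ((Complex.I * s).re : ℂ) = s := by
  apply Complex.ext <;> simp

theorem re_add_I_mul_re (s : ℂ) : (s.re : ℂ) + Complex.I * ((Complex.I * s).re : ℂ) = conj s := by
  apply Complex.ext <;> simp

theorem delBar_potential (b : ℝ) (w y : EuclideanSpace ℂ (Fin n)) :
    delBar (fun x => (potential n b x : ℂ)) w y =
      ((1 / b * (1 + ‖y‖ ^ 2)⁻¹ : ℝ) : ℂ) * inner ℂ w y := by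
  have h1 : HasFDerivAt (potential n b) ((1 / b) • ((1 + ‖y‖ ^ 2)⁻¹ • (2 • innerSL ℝ y))) y :=
    ((hasFDerivAt_one_add_norm_sq y).log (one_add_norm_sq_ne_zero y)).const_mul (1 / b)
  have h2 := Complex.ofRealCLM.hasFDerivAt.comp y h1
  have h3 : fderiv ℝ (fun x => (potential n b x : ℂ)) y = _ := h2.fderiv
  rw [delBar, h3]
  simp only [ContinuousLinearMap.comp_apply, smul_apply, innerSL_real_apply,
    inner_smul_right, Complex.ofRealCLM_apply, smul_eq_mul, nsmul_eq_mul]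
  rw [← inner_conj_symm w y, ← re_add_I_mul_re]
  push_cast
  ring

theorem complexHessian_potential (b : ℝ) (z v w : EuclideanSpace ℂ (Fin n)) :
    complexHessian (potential n b) z v w =
      1 / b * (((1 + ‖z‖ ^ 2 : ℝ) * inner ℂ w v - inner ℂ w z * inner ℂ z v) /
        ((1 + ‖z‖ ^ 2 : ℝ) : ℂ) ^ 2) := by
  have h1 : HasFDerivAt (fun y : EuclideanSpace ℂ (Fin n) => 1 / b * (1 + ‖y‖ ^ 2)⁻¹)
      ((1 / b) • (-((1 + ‖z‖ ^ 2) ^ 2)⁻¹ • (2 • innerSL ℝ z))) z :=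
    ((hasDerivAt_inv (one_add_norm_sq_ne_zero z)).comp_hasFDerivAt z
      (hasFDerivAt_one_add_norm_sq z)).const_mul (1 / b)
  have h2 := Complex.ofRealCLM.hasFDerivAt.comp z h1
  have h3 : HasFDerivAt (fun y : EuclideanSpace ℂ (Fin n) => inner ℂ w y)
      ((innerSL ℂ w).restrictScalars ℝ) z := ((innerSL ℂ w).restrictScalars ℝ).hasFDerivAt
  have h4 : (fun y => delBar (fun x => (potential n b x : ℂ)) w y) =
      (Complex.ofRealCLM ∘ fun y => 1 / b * (1 + ‖y‖ ^ 2)⁻¹) * fun y => inner ℂ w y := by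
    ext y
    exact delBar_potential b w y
  rw [complexHessian, del, h4, (h2.mul h3).fderiv]
  simp only [ContinuousLinearMap.comp_apply, smul_apply, innerSL_real_apply, add_apply]
  simp only [ContinuousLinearMap.coe_restrictScalars', Function.comp_apply,
    innerSL_apply_apply, inner_smul_right, Complex.ofRealCLM_apply, smul_eq_mul, nsmul_eq_mul]
  have hne : ((1 + ‖z‖ ^ 2 : ℝ) : ℂ) ≠ 0 := by exact_mod_cast one_add_norm_sq_ne_zero z
  have key := re_sub_I_mul_re (inner ℂ z v)
  push_cast at hne ⊢
  field_simp
  linear_combination (-2 * inner ℂ w z / b) * key -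
    (1 + (‖z‖ : ℂ) ^ 2) * inner ℂ w v / b * Complex.I_sq

end Hessian

theorem deriv_affineLift {F : ℂ → EuclideanSpace ℂ (Fin 2)} {t : ℂ}
    (hF : DifferentiableAt ℂ F t) :
    deriv (fun s => affineLift 0 (F s)) t 0 = 0 ∧
      ∀ j : Fin 2, deriv (fun s => affineLift 0 (F s)) t j.succ = deriv F t j := by
  have hd := (((contDiff_affineLift (n := 2) 0).differentiable (by simp) (F t)).comp t
    hF).hasDerivAt
  have hd' : ∀ j, HasDerivAt (fun s => affineLift 0 (F s) j)
      (deriv (fun s => affineLift 0 (F s)) t j) t := fun j =>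
    (EuclideanSpace.proj (𝕜 := ℂ) j).hasFDerivAt.comp_hasDerivAt t hd
  constructor
  · have h := hd' 0
    simp only [affineLift_same] at h
    exact h.unique (hasDerivAt_const t 1)
  · intro j
    have h := hd' ((0 : Fin 3).succAbove j)
    simp only [affineLift_succAbove] at h
    exact h.unique ((EuclideanSpace.proj (𝕜 := ℂ) j).hasFDerivAt.comp_hasDerivAt t hF.hasDerivAt)

/-- The potential is the same function in every affine chart, so the `1` may be inserted in position
`0` whichever chart `F` comes from. The lift has velocity zero in that position, which reduces the
inner products to those of `F`. -/
theorem complexHessian_eq_gramForm {F : ℂ → EuclideanSpace ℂ (Fin 2)} {t : ℂ}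
    (hF : DifferentiableAt ℂ F t) (b : ℝ) :
    complexHessian (potential 2 b) (F t) (deriv F t) (deriv F t) =
      1 / b * gramForm (affineLift 0 (F t)) (deriv (fun s => affineLift 0 (F s)) t) := by
  obtain ⟨e0, eS⟩ := deriv_affineLift hF
  have l0 := affineLift_same 0 (F t)
  have lS : ∀ j : Fin 2, affineLift 0 (F t) j.succ = F t j := affineLift_succAbove 0 (F t)
  have i1 : inner ℂ (affineLift 0 (F t)) (affineLift 0 (F t)) = ((1 + ‖F t‖ ^ 2 : ℝ) : ℂ) := by
    rw [PiLp.inner_apply, Fin.sum_univ_succ]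
    simp only [l0, lS]
    rw [← PiLp.inner_apply, inner_self_eq_norm_sq_to_K]
    simp
  have i2 : ∀ x v : EuclideanSpace ℂ (Fin 3), x 0 * v 0 = 0 → ∀ y u : EuclideanSpace ℂ (Fin 2),
      (∀ j : Fin 2, x j.succ = y j) → (∀ j : Fin 2, v j.succ = u j) →
      inner ℂ x v = inner ℂ y u := by
    intro x v h0 y u hx hv
    have h0' : inner ℂ (x 0) (v 0) = 0 := by
      rcases mul_eq_zero.1 h0 with h | h <;> simp [h]
    rw [PiLp.inner_apply, Fin.sum_univ_succ, h0', zero_add, PiLp.inner_apply]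
    simp only [hx, hv]
  rw [complexHessian_potential, gramForm, i1, i2 _ _ (by rw [e0, mul_zero]) _ _ eS eS,
    i2 _ _ (by rw [e0, mul_zero]) _ _ lS eS, i2 _ _ (by rw [e0, zero_mul]) _ _ eS lS]

theorem false_of_complexHessian_eq {b b' : ℝ} (hb : 0 < b) (hb' : 0 < b') (h1 : 1 < b' / b)
    (h2 : b' / b ≠ 2) {F G : ℂ → EuclideanSpace ℂ (Fin 2)} {r : ℝ} (hr : 0 < r)
    (hF : DifferentiableOn ℂ F (ball 0 r)) (hG : DifferentiableOn ℂ G (ball 0 r))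
    (hF0 : deriv F 0 ≠ 0)
    (heq : ∀ t ∈ ball (0 : ℂ) r,
      complexHessian (potential 2 b) (F t) (deriv F t) (deriv F t) =
        complexHessian (potential 2 b') (G t) (deriv G t) (deriv G t)) : False := by
  have hlift : Differentiable ℂ (affineLift (n := 2) 0) :=
    (contDiff_affineLift 0).differentiable (by simp)
  refine false_of_gramForm_eq h1 h2 hr (X := fun s => affineLift 0 (F s))
    (Y := fun s => affineLift 0 (G s)) (hlift.comp_differentiableOn hF)
    (hlift.comp_differentiableOn hG) (affineLift_ne_zero _ _) (affineLift_ne_zero _ _) ?_ ?_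
  · intro c hc
    obtain ⟨e0, eS⟩ := deriv_affineLift (hF.differentiableAt (ball_mem_nhds 0 hr))
    -- Coordinate `0` of the lift is constantly `1`, so a velocity proportional to the position is
    -- zero.
    have hc0 : c = 0 := by
      have := congrArg (fun x : EuclideanSpace ℂ (Fin 3) => x 0) hc
      simpa [e0] using this.symm
    rw [hc0, zero_smul] at hc
    refine hF0 ?_
    ext j
    rw [← eS j, hc]
    simp
  · intro t ht
    have h := heq t ht
    rw [complexHessian_eq_gramForm (hF.differentiableAt (isOpen_ball.mem_nhds ht)),
      complexHessian_eq_gramForm (hG.differentiableAt (isOpen_ball.mem_nhds ht))] at h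
    have hbC : (b : ℂ) ≠ 0 := by exact_mod_cast hb.ne'
    have hbC' : (b' : ℂ) ≠ 0 := by exact_mod_cast hb'.ne'
    push_cast
    field_simp at h ⊢
    linear_combination h

/-! ### From relatives to a pair of curves -/

/-- `chartAt` jumps with `firstIndex`, so `metric` and `mfderiv` refer to one chart only where it is
constant. The least index whose coordinate is nonzero somewhere on `V` is the first index wherever
that coordinate is nonzero, an open condition. -/
theorem exists_firstIndex_eq {Z : Type*} [TopologicalSpace Z] {n : ℕ} {f : Z → CP n}
    (hf : Continuous f) {V : Set Z} (hV : IsOpen V) (hne : V.Nonempty) :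
    ∃ U ⊆ V, IsOpen U ∧ U.Nonempty ∧ ∃ i, ∀ z ∈ U, firstIndex (f z) = i := by
  have hS : ∃ i, ∃ z ∈ V, (f z).rep i ≠ 0 := by
    obtain ⟨z, hz⟩ := hne
    exact ⟨_, z, hz, rep_firstIndex_ne_zero (f z)⟩
  obtain ⟨i, ⟨z, hz, hzi⟩, hmin⟩ := WellFounded.has_min (wellFounded_lt (α := Fin (n + 1)))
    {i | ∃ z ∈ V, (f z).rep i ≠ 0} hS
  refine ⟨V ∩ f ⁻¹' {x | x.rep i ≠ 0}, Set.inter_subset_left,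
    hV.inter ((isOpen_rep_ne_zero i).preimage hf), ⟨z, hz, hzi⟩, i, ?_⟩
  rintro y ⟨hy, hyi⟩
  refine le_antisymm (Finset.min'_le _ _ (by simpa using hyi)) ?_
  exact not_lt.1 (hmin _ ⟨y, hy, rep_firstIndex_ne_zero (f y)⟩)

theorem hasDerivAt_chart_comp {k n : ℕ} {Z : Type*} [TopologicalSpace Z]
    [ChartedSpace (EuclideanSpace ℂ (Fin k)) Z] {f : Z → CP n} {γ : ℂ → Z} {t : ℂ}
    (hf : MDifferentiableAt 𝓘(ℂ, EuclideanSpace ℂ (Fin k)) 𝓘(ℂ, EuclideanSpace ℂ (Fin n)) f (γ t))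
    (hγ : MDifferentiableAt 𝓘(ℂ, ℂ) 𝓘(ℂ, EuclideanSpace ℂ (Fin k)) γ t) {i : Fin (n + 1)}
    (hi : firstIndex (f (γ t)) = i) :
    HasDerivAt (fun s => affineChart i (f (γ s)))
      (mfderiv 𝓘(ℂ, EuclideanSpace ℂ (Fin k)) 𝓘(ℂ, EuclideanSpace ℂ (Fin n)) f (γ t)
        (mfderiv 𝓘(ℂ, ℂ) 𝓘(ℂ, EuclideanSpace ℂ (Fin k)) γ t (1 : ℂ)) :
        EuclideanSpace ℂ (Fin n)) t := by
  subst hi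
  have h := (hf.hasMFDerivAt.comp t hγ.hasMFDerivAt).2
  simp only [writtenInExtChartAt, mfld_simps] at h
  have h' : HasFDerivWithinAt
      (fun s => chartAt (EuclideanSpace ℂ (Fin n)) (f (γ t)) (f (γ s)))
      (show ℂ →L[ℂ] EuclideanSpace ℂ (Fin n) from
        (mfderiv 𝓘(ℂ, EuclideanSpace ℂ (Fin k)) 𝓘(ℂ, EuclideanSpace ℂ (Fin n)) f (γ t)).comp
          (mfderiv 𝓘(ℂ, ℂ) 𝓘(ℂ, EuclideanSpace ℂ (Fin k)) γ t)) Set.univ t := h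
  exact (hasFDerivWithinAt_univ.1 h').hasDerivAt

/-- The curves are the images of a complex line in a chart of `Z`. Both velocities are recorded as
nonzero because either curve may have to serve as the one to be straightened. -/
theorem exists_curves_of_relatives {b b' : ℝ} (h : Relatives (metric 2 b) (metric 2 b')) :
    ∃ (F G : ℂ → EuclideanSpace ℂ (Fin 2)) (r : ℝ), 0 < r ∧ DifferentiableOn ℂ F (ball 0 r) ∧
      DifferentiableOn ℂ G (ball 0 r) ∧ deriv F 0 ≠ 0 ∧ deriv G 0 ≠ 0 ∧
      ∀ t ∈ ball (0 : ℂ) r,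
        complexHessian (potential 2 b) (F t) (deriv F t) (deriv F t) =
          complexHessian (potential 2 b') (G t) (deriv G t) (deriv G t) := by
  obtain ⟨k, Z, _, _, hk, ⟨x₀⟩, -, -, hZ, f, f', hf, hf', hif, hif', hmet⟩ := h
  have : IsManifold 𝓘(ℂ, EuclideanSpace ℂ (Fin k)) 1 Z := IsManifold.of_le (n := ω) (by simp)
  obtain ⟨V, -, hV, hVne, i, hi⟩ :=
    exists_firstIndex_eq hf.continuous isOpen_univ ⟨x₀, Set.mem_univ _⟩
  obtain ⟨U, hUV, hU, ⟨z₀, hz₀⟩, j, hj⟩ := exists_firstIndex_eq hf'.continuous hV hVne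
  set c := chartAt (EuclideanSpace ℂ (Fin k)) z₀ with hc
  have hcm : c.MDifferentiable 𝓘(ℂ, EuclideanSpace ℂ (Fin k)) 𝓘(ℂ, EuclideanSpace ℂ (Fin k)) :=
    mdifferentiable_chart z₀
  set e : EuclideanSpace ℂ (Fin k) := EuclideanSpace.single ⟨0, hk⟩ 1 with he
  have he0 : e ≠ 0 := by simp [he]
  set ℓ : ℂ → EuclideanSpace ℂ (Fin k) := fun t => c z₀ + t • e with hℓ
  have hℓd : ∀ t, HasDerivAt ℓ e t := fun t => by
    have h := ((hasDerivAt_id t).smul_const e).const_add (c z₀)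
    rw [one_smul] at h
    exact h
  have hℓ0 : ℓ 0 = c z₀ := by simp [hℓ]
  have hsource : z₀ ∈ c.source := mem_chart_source _ z₀
  have htarget : ℓ 0 ∈ c.target := by rw [hℓ0]; exact c.map_source hsource
  have ev1 : ∀ᶠ t in 𝓝 (0 : ℂ), ℓ t ∈ c.target :=
    (hℓd 0).continuousAt.eventually_mem (c.open_target.mem_nhds htarget)
  have hγ0 : c.symm (ℓ 0) = z₀ := by rw [hℓ0]; exact c.left_inv hsource
  have ev2 : ∀ᶠ t in 𝓝 (0 : ℂ), c.symm (ℓ t) ∈ U := by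
    have h1 : ContinuousAt (fun t => c.symm (ℓ t)) 0 :=
      (c.continuousAt_symm htarget).comp (hℓd 0).continuousAt
    refine h1.eventually_mem ?_
    rw [hγ0]
    exact hU.mem_nhds hz₀
  obtain ⟨r, hr, hball⟩ := Metric.eventually_nhds_iff_ball.1 (ev1.and ev2)
  set γ : ℂ → Z := c.symm ∘ ℓ with hγ
  have hℓm : ∀ t, MDifferentiableAt 𝓘(ℂ, ℂ) 𝓘(ℂ, EuclideanSpace ℂ (Fin k)) ℓ t := fun t =>
    (hℓd t).differentiableAt.mdifferentiableAt
  have hγm : ∀ t ∈ ball (0 : ℂ) r, MDifferentiableAt 𝓘(ℂ, ℂ) 𝓘(ℂ, EuclideanSpace ℂ (Fin k)) γ t :=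
    fun t ht => (hcm.mdifferentiableAt_symm (hball t ht).1).comp t (hℓm t)
  have hF := fun t (ht : t ∈ ball (0 : ℂ) r) =>
    hasDerivAt_chart_comp (hf (γ t)) (hγm t ht) (hi _ (hUV (hball t ht).2))
  have hG := fun t (ht : t ∈ ball (0 : ℂ) r) =>
    hasDerivAt_chart_comp (hf' (γ t)) (hγm t ht) (hj _ (hball t ht).2)
  have h0 : (0 : ℂ) ∈ ball (0 : ℂ) r := mem_ball_self hr
  have hv : (mfderiv 𝓘(ℂ, ℂ) 𝓘(ℂ, EuclideanSpace ℂ (Fin k)) γ 0 (1 : ℂ)) ≠ 0 := by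
    rw [hγ, mfderiv_comp 0 (hcm.mdifferentiableAt_symm htarget) (hℓm 0), mfderiv_eq_fderiv]
    intro h
    have h1 : fderiv ℂ ℓ 0 1 = 0 :=
      hcm.symm.mfderiv_injective htarget (h.trans (map_zero _).symm)
    rw [fderiv_apply_one_eq_deriv, (hℓd 0).deriv] at h1
    exact he0 h1
  refine ⟨_, _, r, hr, fun t ht => (hF t ht).differentiableAt.differentiableWithinAt,
    fun t ht => (hG t ht).differentiableAt.differentiableWithinAt, ?_, ?_, ?_⟩
  · rw [(hF 0 h0).deriv]
    exact fun h => hv (hif _ (h.trans (map_zero _).symm))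
  · rw [(hG 0 h0).deriv]
    exact fun h => hv (hif' _ (h.trans (map_zero _).symm))
  · intro t ht
    rw [(hF t ht).deriv, (hG t ht).deriv]
    -- Only the value of the metrics on the velocity of `γ` paired with itself is needed.
    have h := hmet (γ t) (mfderiv 𝓘(ℂ, ℂ) 𝓘(ℂ, EuclideanSpace ℂ (Fin k)) γ t (1 : ℂ))
      (mfderiv 𝓘(ℂ, ℂ) 𝓘(ℂ, EuclideanSpace ℂ (Fin k)) γ t (1 : ℂ))
    have hi' := hi _ (hUV (hball t ht).2)
    have hj' := hj _ (hball t ht).2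
    subst hi' hj'
    exact h

/-! ### Conclusion -/

/-- `F(2, b)` and `F(2, b')` are not relatives if `b' / b` is greater than `1` and not `2`. -/
theorem not_relatives {b b' : ℝ} (hb : 0 < b) (hb' : 0 < b') (h1 : 1 < b' / b) (h2 : b' / b ≠ 2) :
    ¬ Relatives (metric 2 b) (metric 2 b') := by
  intro h
  obtain ⟨F, G, r, hr, hF, hG, hF0, -, heq⟩ := exists_curves_of_relatives h
  exact false_of_complexHessian_eq hb hb' h1 h2 hr hF hG hF0 heq

/-- `F(2, b)` and `F(2, b')` are not relatives if `b / b'` is greater than `1` and not `2`. -/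
theorem not_relatives_symm {b b' : ℝ} (hb : 0 < b) (hb' : 0 < b') (h1 : 1 < b / b')
    (h2 : b / b' ≠ 2) : ¬ Relatives (metric 2 b) (metric 2 b') := by
  intro h
  obtain ⟨F, G, r, hr, hF, hG, -, hG0, heq⟩ := exists_curves_of_relatives h
  exact false_of_complexHessian_eq hb' hb h1 h2 hr hG hF hG0 fun t ht => (heq t ht).symm

end FubiniStudy

/-- The last hypothesis is not needed: `1 < b / a` and `b / a ≠ 2` suffice. -/
theorem mainTheorem7 (a b : ℕ) (hab : Nat.Coprime a b) (ha : 1 < a) (hlt : a < b)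
    (hbound : a * (a + 3) < 4 * b + 2) :
    (¬ FubiniStudy.Relatives (FubiniStudy.metric 2 1) (FubiniStudy.metric 2 ((b : ℝ) / (a : ℝ))) ∧
      ¬ FubiniStudy.Relatives (FubiniStudy.metric 2 1)
        (FubiniStudy.metric 2 ((a : ℝ) / (b : ℝ)))) ∧
    ¬ FubiniStudy.Relatives (FubiniStudy.metric 2 (a : ℝ)) (FubiniStudy.metric 2 (b : ℝ)) := by
  have ha0 : (0 : ℝ) < a := by exact_mod_cast (by omega : 0 < a)
  have hb0 : (0 : ℝ) < b := by exact_mod_cast (by omega : 0 < b)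
  have h1 : 1 < (b : ℝ) / a := by
    rw [one_lt_div ha0]
    exact_mod_cast hlt
  have h2 : (b : ℝ) / a ≠ 2 := by
    intro h
    rw [div_eq_iff ha0.ne'] at h
    have hba : b = 2 * a := by exact_mod_cast h
    -- If `b = 2a` then `a` divides `b`, and coprimality forces `a = 1`.
    exact ha.ne' (hab.eq_one_of_dvd (hba ▸ dvd_mul_left a 2))
  refine ⟨⟨?_, ?_⟩, FubiniStudy.not_relatives ha0 hb0 h1 h2⟩
  · exact FubiniStudy.not_relatives one_pos (by positivity) (by rwa [div_one]) (by rwa [div_one])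
  · exact FubiniStudy.not_relatives_symm one_pos (by positivity) (by rwa [one_div_div])
      (by rwa [one_div_div])
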